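/- Let $\mathfrak{w}_n$ be the Lie algebra of all derivations of $\mathbb{C}[x_1,\dots,x_n]$, with basis $D_i(\mathbf m)=x_1^{m_1}\cdots x_n^{m_n}\frac{\partial}{\partial x_i}$ ($1\le i\le n$, $\mathbf m\in\mathbb{Z}_{\ge 0}^n$). Let $\mathfrak h$ be the span of the elements $x_i\frac{\partial}{\partial x_i}$, let $\mathfrak a\cong\mathfrak{gl}_n$ be the span of the elements $x_i\frac{\partial}{\partial x_j}$, and fix a triangular decomposition $\mathfrak a=\mathfrak n_-^{\mathfrak a}\oplus\mathfrak h\oplus\mathfrak n_+^{\mathfrak a}$. Let $\mathfrak n_+$ be the (finite-dimensional) span of $\mathfrak n_+^{\mathfrak a}$ and all $\frac{\partial}{\partial x_i}$, and let $\mathfrak n_-$ be the span of $\mathfrak n_-^{\mathfrak a}$ and all $D_i(\mathbf m)$ that lie neither in $\mathfrak a$ nor in $\mathfrak n_+$, so that $\mathfrak w_n=\mathfrak n_-\oplus\mathfrak h\oplus\mathfrak n_+$ is a direct sum of Lie subalgebras. For $\mu\in\mathfrak h^*$ let $M^{\pm}(\mu)=U(\mathfrak w_n)\otimes_{U(\mathfrak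 h\oplus\mathfrak n_\pm)}\mathbb{C}_\mu$, where $\mathfrak h$ acts on $\mathbb{C}_\mu=\mathbb{C}$ by $\mu$ and $\mathfrak n_\pm$ acts by $0$, let $L^+(\mu)$ be the unique simple quotient of $M^+(\mu)$, and let $\overline{L^+(\mu)}=\prod_{\nu\in\mathfrak h^*}L^+(\mu)_\nu$ be the product of its weight spaces with the natural $\mathfrak w_n$-action. For a Lie algebra homomorphism $\lambda:\mathfrak n_+\to\mathbb{C}$ and a $\mathfrak w_n$-module $M$ put $W_\lambda(M)=\{v\in M: xv=\lambda(x)v \text{ for all } x\in\mathfrak n_+\}$, and let $M_\lambda=U(\mathfrak w_n)\otimes_{U(\mathfrak n_+)}\mathbb{C}_\lambda$. Assume that $\mu\in\mathfrak h^*$ is such that $M^-(-\mu)$ is simple. Then for every Lie algebra homomorphism $\lambda:\mathfrak n_+\to\mathbb{C}$: 1. $\dim W_\lambda(\overline{L^+(\mu)})=1$; in particular, $W_\lambda(\overline{L^+(\mu)})$ is a simple $\mathfrak n_+$-module. 2. There is a unique (up to a nonzero scalar) nonzero $\mathfrak w_n$-homomorphism $M_\lambda\to\overline{L^+(\mu)}$.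 Its image $L(\lambda,\mu)$ is a simple $\mathfrak w_n$-module and satisfies $\dim W_\lambda(L(\lambda,\mu))=1$. 3. $\mathrm{Ann}_{U(\mathfrak w_n)}L(\lambda,\mu)=\mathrm{Ann}_{U(\mathfrak w_n)}L^+(\mu)$. -/

import Mathlib

noncomputable section

open scoped TensorProduct

attribute [local instance 100] LieRing.ofAssociativeRing

namespace WittWhittaker

/-! ### Generalities on modules over complex Lie algebras -/

section General

variable {g : Type} [LieRing g] [LieAlgebra ℂ g]

/-- The universal enveloping algebra `U(g)`. -/
abbrev U (g : Type) [LieRing g] [LieAlgebra ℂ g] : Type := UniversalEnvelopingAlgebra ℂ g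

/-- The canonical map `g → U(g)`. -/
abbrev toU (x : g) : U g := UniversalEnvelopingAlgebra.ι ℂ x

/-- The one-dimensional module `ℂ_χ` of a Lie algebra `b` attached to a character `χ` of `b`. -/
def CharModule {b : Type} [LieRing b] [LieAlgebra ℂ b]
    (_χ : LieAlgebra.LieCharacter ℂ b) : Type := ℂ

namespace CharModule

variable {b : Type} [LieRing b] [LieAlgebra ℂ b] (χ : LieAlgebra.LieCharacter ℂ b)

instance : AddCommGroup (CharModule χ) := inferInstanceAs (AddCommGroup ℂ)

instance : Module ℂ (CharModule χ) := inferInstanceAs (Module ℂ ℂ)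

instance : LieRingModule b (CharModule χ) where
  bracket x v := χ x • v
  add_lie x y v := by
    rw [map_add, add_smul]
  lie_add x v w := smul_add (χ x) v w
  leibniz_lie x y v := by
    change χ x • χ y • v = χ ⁅x, y⁆ • v + χ y • χ x • v
    rw [LieAlgebra.lieCharacter_apply_lie, zero_smul, zero_add, smul_comm]

theorem lie_def (x : b) (v : CharModule χ) : ⁅x, v⁆ = χ x • v := rfl

instance : LieModule ℂ b (CharModule χ) where
  smul_lie t x v := by
    rw [lie_def, lie_def, map_smul, smul_assoc]
  lie_smul t x v := by
    rw [lie_def, lie_def, smul_comm]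

end CharModule

/-- The relations `u x ⊗ v = u ⊗ x v`, for `u ∈ U(g)`, `x ∈ b`, `v ∈ V`, that define the tensor
product over `U(b)`; their linear span is stable under left multiplication by `U(g)`. -/
def indRel (b : LieSubalgebra ℂ g) (V : Type) [AddCommGroup V] [Module ℂ V]
    [LieRingModule b V] : Submodule (U g) (U g ⊗[ℂ] V) :=
  Submodule.span (U g)
    {t | ∃ (u : U g) (x : b) (v : V), t = (u * toU (x : g)) ⊗ₜ[ℂ] v - u ⊗ₜ[ℂ] ⁅x, v⁆}

/-- The induced module `U(g) ⊗_{U(b)} V`. -/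
def Ind (b : LieSubalgebra ℂ g) (V : Type) [AddCommGroup V] [Module ℂ V]
    [LieRingModule b V] : Type :=
  (U g ⊗[ℂ] V) ⧸ indRel b V

namespace Ind

variable (b : LieSubalgebra ℂ g) (V : Type) [AddCommGroup V] [Module ℂ V] [LieRingModule b V]

instance : AddCommGroup (Ind b V) := inferInstanceAs (AddCommGroup ((U g ⊗[ℂ] V) ⧸ indRel b V))

instance : Module (U g) (Ind b V) := inferInstanceAs (Module (U g) ((U g ⊗[ℂ] V) ⧸ indRel b V))

instance : Module ℂ (Ind b V) := inferInstanceAs (Module ℂ ((U g ⊗[ℂ] V) ⧸ indRel b V))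

instance : IsScalarTower ℂ (U g) (Ind b V) :=
  inferInstanceAs (IsScalarTower ℂ (U g) ((U g ⊗[ℂ] V) ⧸ indRel b V))

/-- `g` acts on the induced module by left multiplication in `U(g)`. -/
instance : LieRingModule g (Ind b V) where
  bracket x m := toU x • m
  add_lie x y m := by
    rw [toU, map_add, add_smul]
  lie_add x m m' := smul_add (toU x) m m'
  leibniz_lie x y m := by
    change toU x • toU y • m = toU ⁅x, y⁆ • m + toU y • toU x • m
    simp only [toU, LieHom.map_lie, LieRing.of_associative_ring_bracket, sub_smul, mul_smul,
      sub_add_cancel]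

theorem lie_def (x : g) (m : Ind b V) : ⁅x, m⁆ = toU x • m := rfl

instance : LieModule ℂ g (Ind b V) where
  smul_lie t x m := by
    rw [lie_def, lie_def, toU, map_smul, smul_assoc]
  lie_smul t x m := by
    rw [lie_def, lie_def, smul_algebra_smul_comm]

end Ind

/-- The annihilator `Ann_{U(g)} M` of a `g`-module `M`, i.e. the kernel of the algebra
homomorphism `U(g) → End_ℂ M` that extends the action of `g`. -/
def annihilator (g : Type) [LieRing g] [LieAlgebra ℂ g] (M : Type) [AddCommGroup M] [Module ℂ M]
    [LieRingModule g M] [LieModule ℂ g M] : Ideal (U g) :=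
  RingHom.ker (UniversalEnvelopingAlgebra.lift ℂ (LieModule.toEnd ℂ g M))

/-- The space `W_χ(M)` of `χ`-Whittaker vectors (including `0`) of a `g`-module `M`, where `χ` is
a character of a subalgebra `a` of `g`, as an `a`-submodule of `M`. -/
def whittaker {a : LieSubalgebra ℂ g} (χ : LieAlgebra.LieCharacter ℂ a)
    (M : Type) [AddCommGroup M] [Module ℂ M] [LieRingModule g M] [LieModule ℂ g M] :
    LieSubmodule ℂ a M where
  carrier := {v | ∀ x : a, ⁅x, v⁆ = χ x • v}
  add_mem' {v w} hv hw x := by rw [lie_add, hv x, hw x, smul_add]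
  zero_mem' x := by rw [lie_zero, smul_zero]
  smul_mem' t v hv x := by rw [lie_smul, hv x, smul_comm]
  lie_mem {y v} hv x := by
    have hv' : ∀ x : a, ⁅x, v⁆ = χ x • v := hv
    rw [hv' y, lie_smul, hv' x, smul_comm]

end General

/-! ### The Witt algebra -/

/-- The Witt algebra of all derivations of `ℂ[x₁, …, xₙ]`. -/
abbrev Witt (n : ℕ) : Type :=
  Derivation ℂ (MvPolynomial (Fin n) ℂ) (MvPolynomial (Fin n) ℂ)

/-- Pairs `(i, m)`, indexing the derivations `D_i(m)`. -/
abbrev Idx (n : ℕ) : Type := Fin n × (Fin n →₀ ℕ)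

/-- The exponent vector `e_i` of the monomial `x_i`. -/
abbrev e {n : ℕ} (i : Fin n) : Fin n →₀ ℕ := Finsupp.single i 1

variable {n : ℕ}

/-- The derivation `D_i(m) = x^m ∂/∂x_i`, for `p = (i, m)`. -/
def D (p : Idx n) : Witt n := MvPolynomial.monomial p.2 (1 : ℂ) • MvPolynomial.pderiv p.1

theorem D_X (p : Idx n) (j : Fin n) :
    D p (MvPolynomial.X j) = if j = p.1 then MvPolynomial.monomial p.2 1 else 0 := by
  by_cases h : j = p.1
  · subst h; simp [D]
  · simp [D, MvPolynomial.pderiv_X_of_ne h, h]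

theorem D_monomial (p : Idx n) (s : Fin n →₀ ℕ) :
    D p (MvPolynomial.monomial s 1) =
      (s p.1 : ℂ) • MvPolynomial.monomial (p.2 + s - e p.1) 1 := by
  by_cases h : s p.1 = 0
  · simp [D, h]
  · have hs : p.2 + (s - e p.1) = p.2 + s - e p.1 := by
      ext k
      by_cases hk : p.1 = k
      · subst hk; simp; omega
      · simp [Finsupp.single_eq_of_ne' hk]
    simp only [D, Derivation.coe_smul, Pi.smul_apply, MvPolynomial.pderiv_monomial, smul_eq_mul,
      MvPolynomial.monomial_mul, hs, MvPolynomial.smul_monomial]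
    simp

theorem lie_D (p q : Idx n) :
    ⁅D p, D q⁆ = (q.2 p.1 : ℂ) • D (q.1, p.2 + q.2 - e p.1)
      - (p.2 q.1 : ℂ) • D (p.1, p.2 + q.2 - e q.1) := by
  apply MvPolynomial.derivation_ext
  intro j
  rw [Derivation.commutator_apply, D_X, D_X, Derivation.sub_apply, Derivation.smul_apply,
    Derivation.smul_apply, D_X, D_X]
  congr 1
  · split_ifs
    · rw [D_monomial]
    · simp
  · split_ifs
    · rw [D_monomial, add_comm q.2]
    · simp

/-- The natural basis `{D_i(m)}` of the Witt algebra. -/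
def wittBasis (n : ℕ) : Module.Basis (Idx n) ℂ (Witt n) :=
  ((Pi.basis fun _ : Fin n => MvPolynomial.basisMonomials (Fin n) ℂ).map
    (MvPolynomial.mkDerivationEquiv ℂ)).reindex (Equiv.sigmaEquivProd _ _)

theorem wittBasis_apply (p : Idx n) : wittBasis n p = D p := by
  apply MvPolynomial.derivation_ext
  intro j
  rw [D_X]
  obtain ⟨i, m⟩ := p
  simp [wittBasis, MvPolynomial.mkDerivationEquiv, MvPolynomial.mkDerivation_X, Pi.single_apply]

theorem lie_mem_of_mem_span {g : Type} [LieRing g] [LieAlgebra ℂ g] {T : Set g}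
    {P : Submodule ℂ g} (h : ∀ x ∈ T, ∀ y ∈ T, ⁅x, y⁆ ∈ P) {x y : g}
    (hx : x ∈ Submodule.span ℂ T) (hy : y ∈ Submodule.span ℂ T) : ⁅x, y⁆ ∈ P := by
  induction hx, hy using Submodule.span_induction₂ with
  | mem_mem x y hx hy => exact h x hx y hy
  | zero_left y hy => simp
  | zero_right x hx => simp
  | add_left x y z _ _ _ h1 h2 => rw [add_lie]; exact Submodule.add_mem _ h1 h2
  | add_right x y z _ _ _ h1 h2 => rw [lie_add]; exact Submodule.add_mem _ h1 h2
  | smul_left r x y _ _ h => rw [smul_lie]; exact Submodule.smul_mem _ _ h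
  | smul_right r x y _ _ h => rw [lie_smul]; exact Submodule.smul_mem _ _ h

/-- The condition on a set `S` of indices that makes the span of the `D_i(m)`, `(i, m) ∈ S`,
closed under the bracket. -/
def IsClosedIdx (S : Set (Idx n)) : Prop :=
  ∀ p ∈ S, ∀ q ∈ S, q.2 p.1 ≠ 0 → (q.1, p.2 + q.2 - e p.1) ∈ S

/-- The linear span of the elements `D_i(m)` with `(i, m) ∈ S`, as a Lie subalgebra. -/
def spanD (S : Set (Idx n)) (hS : IsClosedIdx S) :
    LieSubalgebra ℂ (Witt n) where
  toSubmodule := Submodule.span ℂ (D '' S)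
  lie_mem' {x y} hx hy := by
    refine lie_mem_of_mem_span ?_ hx hy
    rintro _ ⟨p, hp, rfl⟩ _ ⟨q, hq, rfl⟩
    change ⁅D p, D q⁆ ∈ _
    rw [lie_D]
    refine Submodule.sub_mem _ ?_ ?_
    · by_cases h : q.2 p.1 = 0
      · simp [h]
      · exact Submodule.smul_mem _ _ (Submodule.subset_span ⟨_, hS p hp q hq h, rfl⟩)
    · by_cases h : p.2 q.1 = 0
      · simp [h]
      · refine Submodule.smul_mem _ _ (Submodule.subset_span ⟨_, ?_, rfl⟩)
        rw [add_comm p.2]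
        exact hS q hq p hp h

/-! ### The subalgebras `𝔥`, `𝔫₊`, `𝔫₋` -/

/-- Indices of the elements `x_i ∂/∂x_i`. -/
def cartanIdx (n : ℕ) : Set (Idx n) := {p | p.2 = e p.1}

/-- Indices of the elements `∂/∂x_i` and of the root vectors `x_j ∂/∂x_i` with `r j i`. -/
def posIdx (r : Fin n → Fin n → Prop) : Set (Idx n) :=
  {p | p.2 = 0 ∨ ∃ j, r j p.1 ∧ p.2 = e j}

/-- Indices of the root vectors `x_j ∂/∂x_i` with `r i j` and of all `D_i(m)` that lie neither in
`𝔤𝔩ₙ` nor in `𝔫₊`, i.e. such that `m` has total degree at least two. -/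
def negIdx (r : Fin n → Fin n → Prop) : Set (Idx n) :=
  {p | (∃ j, r p.1 j ∧ p.2 = e j) ∨ 2 ≤ p.2.degree}

theorem e_apply (i j : Fin n) : e i j = if i = j then 1 else 0 := Finsupp.single_apply

theorem eq_of_e_apply_ne {i j : Fin n} (h : e i j ≠ 0) : i = j := by
  by_contra hij
  exact h (by rw [e_apply, if_neg hij])

theorem e_injective {i j : Fin n} (h : (e i : Fin n →₀ ℕ) = e j) : i = j := by
  refine (eq_of_e_apply_ne (i := j) (j := i) ?_).symm
  rw [← h, e_apply, if_pos rfl]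
  exact one_ne_zero

theorem degree_e (i : Fin n) : (e i).degree = 1 := Finsupp.degree_single i 1

theorem eq_e_add {m : Fin n →₀ ℕ} {i : Fin n} (h : m i ≠ 0) : ∃ k, m = e i + k := by
  refine ⟨m - e i, ?_⟩
  ext j
  have := e_apply i j
  simp only [Finsupp.add_apply, Finsupp.tsub_apply]
  split_ifs at this with hij
  · subst hij; omega
  · omega

theorem add_e_add_sub (a k : Fin n →₀ ℕ) (i : Fin n) : a + (e i + k) - e i = a + k := by
  rw [add_left_comm, add_tsub_cancel_left]

theorem closed_cartanIdx : IsClosedIdx (cartanIdx n) := by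
  rintro ⟨i, m⟩ hp ⟨j, k⟩ hq h
  simp only [cartanIdx, Set.mem_ofPred_eq] at hp hq h ⊢
  subst hp hq
  obtain rfl := eq_of_e_apply_ne h
  simp

section Order

variable (r : Fin n → Fin n → Prop) [IsStrictTotalOrder (Fin n) r]

theorem closed_posIdx : IsClosedIdx (posIdx r) := by
  rintro ⟨i, m⟩ hp ⟨j, k⟩ hq h
  simp only [posIdx, Set.mem_ofPred_eq] at hp hq h ⊢
  rcases hq with rfl | ⟨l, hl, rfl⟩
  · simp at h
  · obtain rfl := eq_of_e_apply_ne h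
    rw [add_tsub_cancel_right]
    rcases hp with rfl | ⟨l', hl', rfl⟩
    · exact Or.inl rfl
    · exact Or.inr ⟨l', _root_.trans hl' hl, rfl⟩

theorem closed_negIdx : IsClosedIdx (negIdx r) := by
  rintro ⟨i, m⟩ hp ⟨j, k⟩ hq h
  simp only [negIdx, Set.mem_ofPred_eq] at hp hq h ⊢
  rcases hq with ⟨l, hl, rfl⟩ | hq
  · obtain rfl := eq_of_e_apply_ne h
    rw [add_tsub_cancel_right]
    rcases hp with ⟨l', hl', rfl⟩ | hp
    · exact Or.inl ⟨l', _root_.trans hl hl', rfl⟩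
    · exact Or.inr hp
  · right
    obtain ⟨k, rfl⟩ := eq_e_add h
    rw [add_e_add_sub, map_add]
    rw [map_add, degree_e] at hq
    have : 1 ≤ m.degree := by
      rcases hp with ⟨l', hl', rfl⟩ | hp
      · rw [degree_e]
      · omega
    omega

theorem closed_union {S : Set (Idx n)} (hS : IsClosedIdx S) : IsClosedIdx (cartanIdx n ∪ S) := by
  intro p hp q hq h
  by_cases hpc : p ∈ cartanIdx n
  · have hpc' : p.2 = e p.1 := hpc
    rw [hpc', add_tsub_cancel_left]
    exact hq
  · by_cases hqc : q ∈ cartanIdx n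
    · have hqc' : q.2 = e q.1 := hqc
      rw [hqc'] at h ⊢
      rw [eq_of_e_apply_ne h, add_tsub_cancel_right]
      exact hp
    · exact Or.inr (hS p (hp.resolve_left hpc) q (hq.resolve_left hqc) h)

theorem posIdx_disjoint {p : Idx n} (hp : p ∈ posIdx r) : p ∉ cartanIdx n := by
  obtain ⟨i, m⟩ := p
  simp only [posIdx, cartanIdx, Set.mem_ofPred_eq] at hp ⊢
  rintro rfl
  rcases hp with h | ⟨j, hj, h⟩
  · simp at h
  · exact irrefl_of r i (e_injective h ▸ hj)

theorem negIdx_disjoint {p : Idx n} (hp : p ∈ negIdx r) : p ∉ cartanIdx n := by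
  obtain ⟨i, m⟩ := p
  simp only [negIdx, cartanIdx, Set.mem_ofPred_eq] at hp ⊢
  rintro rfl
  rcases hp with ⟨j, hj, h⟩ | h
  · exact irrefl_of r i (e_injective h ▸ hj)
  · rw [degree_e] at h; omega

/-- The Cartan subalgebra `𝔥`, spanned by the elements `x_i ∂/∂x_i`. -/
abbrev torus (n : ℕ) : LieSubalgebra ℂ (Witt n) := spanD (cartanIdx n) closed_cartanIdx

/-- The finite-dimensional subalgebra `𝔫₊`. -/
abbrev nPos : LieSubalgebra ℂ (Witt n) := spanD (posIdx r) (closed_posIdx r)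

/-- The subalgebra `𝔫₋`. -/
abbrev nNeg : LieSubalgebra ℂ (Witt n) := spanD (negIdx r) (closed_negIdx r)

/-- The subalgebra `𝔥 ⊕ 𝔫₊`. -/
abbrev bPos : LieSubalgebra ℂ (Witt n) :=
  spanD (cartanIdx n ∪ posIdx r) (closed_union (closed_posIdx r))

/-- The subalgebra `𝔥 ⊕ 𝔫₋`. -/
abbrev bNeg : LieSubalgebra ℂ (Witt n) :=
  spanD (cartanIdx n ∪ negIdx r) (closed_union (closed_negIdx r))

end Order

theorem D_mem_spanD {S : Set (Idx n)} (hS : IsClosedIdx S) {p : Idx n} (hp : p ∈ S) :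
    D p ∈ spanD S hS :=
  Submodule.subset_span ⟨p, hp, rfl⟩

open Classical in
/-- The linear projection of the Witt algebra onto `𝔥` that kills all `D_i(m)` not in `𝔥`. -/
def torusProj (n : ℕ) : Witt n →ₗ[ℂ] torus n :=
  (wittBasis n).constr ℂ fun p =>
    if h : p ∈ cartanIdx n then ⟨D p, D_mem_spanD closed_cartanIdx h⟩ else 0

theorem torusProj_D_of_notMem {p : Idx n} (h : p ∉ cartanIdx n) : torusProj n (D p) = 0 := by
  rw [← wittBasis_apply, torusProj, Module.Basis.constr_basis, dif_neg h]

theorem sub_smul_witt (a b : ℂ) (x : Witt n) : (a - b) • x = a • x - b • x := by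
  apply MvPolynomial.derivation_ext
  intro j
  simp only [Derivation.smul_apply, Derivation.sub_apply, sub_smul]

theorem lie_cartan_D {p : Idx n} (hp : p ∈ cartanIdx n) (q : Idx n) :
    ⁅D p, D q⁆ = ((q.2 p.1 : ℂ) - (e p.1 q.1 : ℂ)) • D q := by
  have hp' : p.2 = e p.1 := hp
  have h1 : (q.1, p.2 + q.2 - e p.1) = q := by rw [hp', add_tsub_cancel_left]
  have h2 : (p.2 q.1 : ℂ) • D (p.1, p.2 + q.2 - e q.1) = (e p.1 q.1 : ℂ) • D q := by
    rw [hp']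
    by_cases h : e p.1 q.1 = 0
    · rw [h, Nat.cast_zero, zero_smul, zero_smul]
    · rw [eq_of_e_apply_ne h, add_tsub_cancel_left]
  rw [lie_D, h1, h2, sub_smul_witt]

theorem torusProj_lie {S : Set (Idx n)} (hS : IsClosedIdx S) (hd : ∀ p ∈ S, p ∉ cartanIdx n)
    {x y : Witt n} (hx : x ∈ spanD (cartanIdx n ∪ S) (closed_union hS))
    (hy : y ∈ spanD (cartanIdx n ∪ S) (closed_union hS)) :
    torusProj n ⁅x, y⁆ = 0 := by
  have key : ∀ p ∈ cartanIdx n, ∀ q, torusProj n ⁅D p, D q⁆ = 0 := by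
    intro p hp q
    rw [lie_cartan_D hp, map_smul]
    by_cases hq : q ∈ cartanIdx n
    · have hq' : q.2 = e q.1 := hq
      rw [hq', e_apply, e_apply]
      simp [eq_comm]
    · rw [torusProj_D_of_notMem hq, smul_zero]
  refine lie_mem_of_mem_span (P := LinearMap.ker (torusProj n)) ?_ hx hy
  rintro _ ⟨p, hp, rfl⟩ _ ⟨q, hq, rfl⟩
  change torusProj n ⁅D p, D q⁆ = 0
  rcases hp with hp | hp
  · exact key p hp q
  · rcases hq with hq | hq
    · have h := key q hq p
      rw [← lie_skew] at h
      rw [map_neg, neg_eq_zero] at h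
      exact h
    · have h : ⁅D p, D q⁆ ∈ Submodule.span ℂ (D '' S) :=
        (spanD S hS).lie_mem (D_mem_spanD hS hp) (D_mem_spanD hS hq)
      have h2 : Submodule.span ℂ (D '' S) ≤ LinearMap.ker (torusProj n) := by
        rw [Submodule.span_le]
        rintro _ ⟨p, hp, rfl⟩
        exact torusProj_D_of_notMem (hd p hp)
      exact h2 h

/-- The character of `𝔥 ⊕ 𝔫` that extends `μ ∈ 𝔥*` by zero on `𝔫`, where `𝔫` is the span of the
`D_i(m)` with `(i, m) ∈ S`. -/
def extendChar {S : Set (Idx n)} (hS : IsClosedIdx S) (hd : ∀ p ∈ S, p ∉ cartanIdx n)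
    (μ : Module.Dual ℂ (torus n)) :
    LieAlgebra.LieCharacter ℂ (spanD (cartanIdx n ∪ S) (closed_union hS)) where
  toLinearMap := μ ∘ₗ torusProj n ∘ₗ (spanD (cartanIdx n ∪ S) (closed_union hS)).toSubmodule.subtype
  map_lie' {x y} := by
    have h : torusProj n ⁅(x : Witt n), (y : Witt n)⁆ = 0 := torusProj_lie hS hd x.2 y.2
    have h2 : ∀ a b : ℂ, ⁅a, b⁆ = 0 := fun a b => by
      rw [LieRing.of_associative_ring_bracket, mul_comm, sub_self]
    rw [h2]
    change μ (torusProj n ⁅(x : Witt n), (y : Witt n)⁆) = 0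
    rw [h, map_zero]

/-! ### Highest and lowest weight modules, standard Whittaker modules -/

section Modules

variable (r : Fin n → Fin n → Prop) [IsStrictTotalOrder (Fin n) r]

/-- The highest weight Verma module `M⁺(μ) = U(𝔴ₙ) ⊗_{U(𝔥 ⊕ 𝔫₊)} ℂ_μ`. -/
abbrev MPos (μ : Module.Dual ℂ (torus n)) : Type :=
  Ind (bPos r) (CharModule (extendChar (closed_posIdx r) (fun _ => posIdx_disjoint r) μ))

/-- The lowest weight Verma module `M⁻(μ) = U(𝔴ₙ) ⊗_{U(𝔥 ⊕ 𝔫₋)} ℂ_μ`. -/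
abbrev MNeg (μ : Module.Dual ℂ (torus n)) : Type :=
  Ind (bNeg r) (CharModule (extendChar (closed_negIdx r) (fun _ => negIdx_disjoint r) μ))

/-- The simple highest weight module `L⁺(μ)`: the quotient of `M⁺(μ)` by the sum of all its proper
submodules. -/
abbrev LPos (μ : Module.Dual ℂ (torus n)) : Type :=
  MPos r μ ⧸ sSup {N : LieSubmodule ℂ (Witt n) (MPos r μ) | N ≠ ⊤}

/-- The standard Whittaker module `M_χ = U(𝔴ₙ) ⊗_{U(𝔫₊)} ℂ_χ`. -/
abbrev MStd (χ : LieAlgebra.LieCharacter ℂ (nPos r)) : Type :=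
  Ind (nPos r) (CharModule χ)

end Modules

/-! ### Completions -/

/-- The linear form on `𝔥` that reads off the coefficient at `x_k ∂/∂x_k`. -/
def torusCoord (k : Fin n) : Module.Dual ℂ (torus n) :=
  (wittBasis n).coord (k, e k) ∘ₗ (torus n).toSubmodule.subtype

/-- The weight `m - e_i ∈ 𝔥*` of the element `D_i(m)`. -/
def wt (p : Idx n) : Module.Dual ℂ (torus n) :=
  (∑ k, (p.2 k : ℂ) • torusCoord k) - torusCoord p.1

theorem lie_torus_D (h : torus n) (p : Idx n) : ⁅(h : Witt n), D p⁆ = wt p h • D p := by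
  obtain ⟨h, hh⟩ := h
  have hh' : h ∈ Submodule.span ℂ (D '' cartanIdx n) := hh
  induction hh' using Submodule.span_induction with
  | mem x hx =>
    obtain ⟨q, hq, rfl⟩ := hx
    obtain ⟨i, m⟩ := q
    have hm : m = e i := hq
    subst hm
    change ⁅D (i, e i), D p⁆ = _
    rw [lie_cartan_D hq]
    congr 1
    have hc : ∀ k, torusCoord k ⟨D (i, e i), hh⟩ = (e i k : ℂ) := by
      intro k
      change (wittBasis n).coord (k, e k) (D (i, e i)) = _
      rw [← wittBasis_apply, Module.Basis.coord_apply, Module.Basis.repr_self, e_apply,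
        Finsupp.single_apply]
      by_cases hik : i = k
      · subst hik; simp
      · simp [hik]
    rw [wt, LinearMap.sub_apply, hc, LinearMap.sum_apply]
    simp only [LinearMap.smul_apply, hc, smul_eq_mul, e_apply]
    simp
  | zero =>
    change ⁅(0 : Witt n), D p⁆ = wt p 0 • D p
    rw [map_zero, zero_smul]
    exact zero_lie (D p)
  | add x y hx hy h1 h2 =>
    have h1' := h1 hx
    have h2' := h2 hy
    change ⁅x + y, D p⁆ = wt p (⟨x, hx⟩ + ⟨y, hy⟩) • D p
    rw [map_add, add_smul, ← h1', ← h2']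
    exact add_lie x y (D p)
  | smul t x hx h1 =>
    have h1' := h1 hx
    change ⁅t • x, D p⁆ = wt p (t • ⟨x, hx⟩) • D p
    rw [map_smul, smul_assoc, ← h1']
    exact smul_lie t x (D p)

theorem wt_add {p q : Idx n} (h : q.2 p.1 ≠ 0) : wt (q.1, p.2 + q.2 - e p.1) = wt p + wt q := by
  obtain ⟨i, m⟩ := p
  obtain ⟨j, k⟩ := q
  obtain ⟨k, rfl⟩ : ∃ k', k = e i + k' := eq_e_add h
  simp only [wt, add_e_add_sub]
  have he : ∑ l, ((e i l : ℕ) : ℂ) • torusCoord l = torusCoord i := by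
    simp only [e_apply]
    simp
  simp only [Finsupp.add_apply, Nat.cast_add, add_smul, Finset.sum_add_distrib, he]
  abel

section Completion

variable (M : Type) [AddCommGroup M] [Module ℂ M] [LieRingModule (Witt n) M]
  [LieModule ℂ (Witt n) M]

/-- The weight space `M_ν`. -/
def wtSpace (ν : Module.Dual ℂ (torus n)) : Submodule ℂ M where
  carrier := {v | ∀ h : torus n, ⁅(h : Witt n), v⁆ = ν h • v}
  add_mem' {v w} hv hw h := by rw [lie_add, hv h, hw h, smul_add]
  zero_mem' h := by rw [lie_zero, smul_zero]
  smul_mem' t v hv h := by rw [lie_smul, hv h, smul_comm]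

variable {M} in
theorem lie_D_mem {p : Idx n} {ν κ : Module.Dual ℂ (torus n)} (hκ : ν + wt p = κ) {v : M}
    (hv : v ∈ wtSpace M ν) : ⁅D p, v⁆ ∈ wtSpace M κ := by
  intro h
  subst hκ
  have hv' : ⁅(h : Witt n), v⁆ = ν h • v := hv h
  have hD : ⁅(h : Witt n), D p⁆ = wt p h • D p := lie_torus_D h p
  rw [leibniz_lie, hv', lie_smul, LinearMap.add_apply, add_smul, add_comm]
  congr 1
  rw [← smul_lie, ← hD]

variable (n)

/-- The completion `∏_ν M_ν` of a weight module `M = ⨁_ν M_ν`. -/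
def Completion : Type := (ν : Module.Dual ℂ (torus n)) → wtSpace M ν

namespace Completion

instance : AddCommGroup (Completion n M) :=
  inferInstanceAs (AddCommGroup ((ν : Module.Dual ℂ (torus n)) → wtSpace M ν))

instance : Module ℂ (Completion n M) :=
  inferInstanceAs (Module ℂ ((ν : Module.Dual ℂ (torus n)) → wtSpace M ν))

variable {n M} in
/-- The component of weight `κ`, viewed in `M`. -/
def comp (f : Completion n M) (κ : Module.Dual ℂ (torus n)) : M := (f κ : M)

variable {n M} in
theorem ext_comp {f f' : Completion n M} (h : ∀ κ, f.comp κ = f'.comp κ) : f = f' :=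
  funext fun κ => Subtype.ext (h κ)

variable {n M} in
theorem comp_sub (f f' : Completion n M) (κ : Module.Dual ℂ (torus n)) :
    (f - f').comp κ = f.comp κ - f'.comp κ := rfl

variable {n M} in
theorem comp_smul (t : ℂ) (f : Completion n M) (κ : Module.Dual ℂ (torus n)) :
    (t • f).comp κ = t • f.comp κ := rfl

variable {n} in
/-- The componentwise action of `D_i(m)`: it maps the component of weight `ν` to the component of
weight `ν + wt (i, m)`. -/
def actD (p : Idx n) : Module.End ℂ (Completion n M) where
  toFun f κ := ⟨⁅D p, f.comp (κ - wt p)⁆, lie_D_mem (sub_add_cancel κ (wt p)) (f (κ - wt p)).2⟩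
  map_add' f f' := ext_comp fun κ => lie_add (D p) (f.comp (κ - wt p)) (f'.comp (κ - wt p))
  map_smul' t f := ext_comp fun κ => lie_smul t (D p) (f.comp (κ - wt p))

variable {n M} in
theorem comp_actD (p : Idx n) (f : Completion n M) (κ : Module.Dual ℂ (torus n)) :
    (actD M p f).comp κ = ⁅D p, f.comp (κ - wt p)⁆ := rfl

/-- The action of the Witt algebra: the linear extension of the action of the `D_i(m)`. -/
def act : Witt n →ₗ[ℂ] Module.End ℂ (Completion n M) := (wittBasis n).constr ℂ (actD M)

variable {n} in
theorem act_D (p : Idx n) : act n M (D p) = actD M p := by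
  rw [← wittBasis_apply, act, Module.Basis.constr_basis]

variable {n} in
theorem act_lie_D (p q : Idx n) :
    act n M ⁅D p, D q⁆ = actD M p * actD M q - actD M q * actD M p := by
  have aux : ∀ (p q : Idx n) (f : Completion n M) (κ : Module.Dual ℂ (torus n)),
      (q.2 p.1 : ℂ) • (actD M (q.1, p.2 + q.2 - e p.1) f).comp κ =
        ⁅(q.2 p.1 : ℂ) • D (q.1, p.2 + q.2 - e p.1), f.comp (κ - wt p - wt q)⁆ := by
    intro p q f κ
    by_cases h : q.2 p.1 = 0
    · rw [h, Nat.cast_zero, zero_smul, zero_smul, zero_lie]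
    · rw [sub_sub, ← wt_add h, comp_actD]
      exact (smul_lie (q.2 p.1 : ℂ) (D (q.1, p.2 + q.2 - e p.1)) _).symm
  refine LinearMap.ext fun f => ext_comp fun κ => ?_
  rw [lie_D, map_sub, map_smul, map_smul, act_D, act_D, LinearMap.sub_apply, LinearMap.sub_apply,
    LinearMap.smul_apply, LinearMap.smul_apply, Module.End.mul_apply, Module.End.mul_apply,
    comp_sub, comp_sub, comp_smul, comp_smul, comp_actD p, comp_actD q, comp_actD q, comp_actD p,
    aux p q f κ, add_comm p.2, aux q p f κ, sub_right_comm κ (wt q), ← lie_lie, ← sub_lie,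
    add_comm q.2]
  have h := lie_D p q
  rw [← h]

theorem act_lie (x y : Witt n) :
    act n M ⁅x, y⁆ = act n M x * act n M y - act n M y * act n M x := by
  have hx : x ∈ Submodule.span ℂ (Set.range (wittBasis n)) := (wittBasis n).mem_span x
  have hy : y ∈ Submodule.span ℂ (Set.range (wittBasis n)) := (wittBasis n).mem_span y
  induction hx, hy using Submodule.span_induction₂ with
  | mem_mem x y hx hy =>
    obtain ⟨p, rfl⟩ := hx
    obtain ⟨q, rfl⟩ := hy
    rw [wittBasis_apply, wittBasis_apply, act_D, act_D]
    exact act_lie_D M p q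
  | zero_left y hy =>
    have h : ⁅(0 : Witt n), y⁆ = 0 := zero_lie y
    rw [h, map_zero, zero_mul, mul_zero, sub_zero]
  | zero_right x hx =>
    have h : ⁅x, (0 : Witt n)⁆ = 0 := lie_zero x
    rw [h, map_zero, zero_mul, mul_zero, sub_zero]
  | add_left x y z _ _ _ h1 h2 =>
    have h : ⁅x + y, z⁆ = ⁅x, z⁆ + ⁅y, z⁆ := add_lie x y z
    rw [h, map_add, h1, h2, map_add, add_mul, mul_add]
    abel
  | add_right x y z _ _ _ h1 h2 =>
    have h : ⁅x, y + z⁆ = ⁅x, y⁆ + ⁅x, z⁆ := lie_add x y z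
    rw [h, map_add, h1, h2, map_add, add_mul, mul_add]
    abel
  | smul_left t x y _ _ h1 =>
    have h : ⁅t • x, y⁆ = t • ⁅x, y⁆ := smul_lie t x y
    rw [h, map_smul, h1, map_smul, smul_sub, smul_mul_assoc, mul_smul_comm]
  | smul_right t x y _ _ h1 =>
    have h : ⁅x, t • y⁆ = t • ⁅x, y⁆ := lie_smul t x y
    rw [h, map_smul, h1, map_smul, smul_sub, smul_mul_assoc, mul_smul_comm]

instance : LieRingModule (Witt n) (Completion n M) where
  bracket x f := act n M x f
  add_lie x y f := by rw [map_add, LinearMap.add_apply]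
  lie_add x f f' := map_add (act n M x) f f'
  leibniz_lie x y f := by
    rw [act_lie, LinearMap.sub_apply, Module.End.mul_apply, Module.End.mul_apply, sub_add_cancel]

theorem lie_def (x : Witt n) (f : Completion n M) : ⁅x, f⁆ = act n M x f := rfl

instance : LieModule ℂ (Witt n) (Completion n M) where
  smul_lie t x f := by rw [lie_def, lie_def, map_smul, LinearMap.smul_apply]
  lie_smul t x f := map_smul (act n M x) t f

end Completion

end Completion

end WittWhittaker

end

noncomputable section

open scoped TensorProduct

attribute [local instance 100] LieRing.ofAssociativeRing

namespace WittWhittaker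

/-! ### Induced modules for a Lie algebra that is a sum of two subalgebras -/

section General

variable {g : Type} [LieRing g] [LieAlgebra ℂ g]

/-! Put $M=M^-(-\mu)$. The point is that the completion of $L^+(\mu)$ is the full algebraic dual
$M^*$. The $\mathfrak n_+$-invariant form on $M$ normalized at the generator is a highest weight
vector of weight $\mu$ in $M^*$; it gives a map $M^+(\mu)\to M^*$ whose kernel is the largest proper
submodule (`ker_pairing`), so $L^+(\mu)$ embeds in $M^*$. Since $M$ is simple, this pairing has no
radical on the side of $M$ either. As $\mathfrak n_+$ is finite-dimensional and strictly graded, the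
weight spaces of $M$ are finite-dimensional (`finite_wtSpace_MNeg`); hence $L^+(\mu)_\kappa$ is the
dual of $M_{-\kappa}$, and the product of these spaces is $M^*$ (`exists_completion_hom_dual`).

A Whittaker vector in $M^*$ is a linear form on which $\mathfrak n_+$ acts by $\lambda$. It is
determined by its value on the generator, because $M=U(\mathfrak n_+)\cdot 1$. It exists because
$\mathfrak w_n$ acts on $U(\mathfrak n_+)$ as on an induced module (`exists_action_U`); this action
is built by hand, without the Poincaré–Birkhoff–Witt theorem. So the Whittaker space is a line
(`exists_whittaker_dual`), and Frobenius reciprocity gives the uniqueness of the map from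
$M_\lambda$.

The image is generated by a Whittaker vector. Since $\mathfrak n_+$ strictly lowers a degree on
$\mathfrak w_n$ that is bounded below, the operators $x-\lambda(x)$ lower a filtration of the image.
Each nonzero submodule therefore contains a Whittaker vector (`exists_mem_whittaker`), and the
uniqueness of the line makes the image simple.

Finally, both $L(\lambda,\mu)$ and $L^+(\mu)$ are nonzero submodules of $M^*$ and separate the
points of the simple module $M$. An element of $U(\mathfrak w_n)$ kills either of them exactly when
its transpose kills $M$ (`annihilator_eq_of_dual`). -/

theorem adjoin_range_toU : Algebra.adjoin ℂ (Set.range (toU : g → U g)) = ⊤ := by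
  set S := Algebra.adjoin ℂ (Set.range (toU : g → U g)) with hS
  let f : g →ₗ⁅ℂ⁆ S :=
    { toFun := fun x => ⟨toU x, Algebra.subset_adjoin ⟨x, rfl⟩⟩
      map_add' := fun x y => Subtype.ext (map_add (UniversalEnvelopingAlgebra.ι ℂ) x y)
      map_smul' := fun t x => Subtype.ext (map_smul (UniversalEnvelopingAlgebra.ι ℂ) t x)
      map_lie' := fun {x y} => Subtype.ext (LieHom.map_lie (UniversalEnvelopingAlgebra.ι ℂ) x y) }
  -- The inclusion of `g` into `S` extends to `U g`; followed by the inclusion of `S` it agrees with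
  -- the identity on generators, so every `u` lies in `S`.
  have h : S.val.comp (UniversalEnvelopingAlgebra.lift ℂ f) = AlgHom.id ℂ (U g) := by
    apply UniversalEnvelopingAlgebra.hom_ext
    ext x
    change S.val (UniversalEnvelopingAlgebra.lift ℂ f (toU x)) = toU x
    rw [toU, UniversalEnvelopingAlgebra.lift_ι_apply]
    rfl
  rw [eq_top_iff]
  intro u _
  have hu := DFunLike.congr_fun h u
  rw [← show S.val (UniversalEnvelopingAlgebra.lift ℂ f u) = u from hu]
  exact (UniversalEnvelopingAlgebra.lift ℂ f u).2

/-- A subspace of `U(g)` that contains `1` and is stable under left multiplication by `g` is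
everything. -/
theorem submodule_U_eq_top {T : Submodule ℂ (U g)} (h1 : 1 ∈ T)
    (h : ∀ (x : g), ∀ t ∈ T, toU x * t ∈ T) : T = ⊤ := by
  have key : ∀ u : U g, ∀ t ∈ T, u * t ∈ T := by
    intro u
    have hu : u ∈ Algebra.adjoin ℂ (Set.range (toU : g → U g)) := by
      rw [adjoin_range_toU]; trivial
    induction hu using Algebra.adjoin_induction with
    | mem x hx => obtain ⟨x, rfl⟩ := hx; exact h x
    | algebraMap c =>
      intro t ht
      rw [← Algebra.smul_def]
      exact T.smul_mem c ht
    | add x y _ _ hx hy => intro t ht; rw [add_mul]; exact T.add_mem (hx t ht) (hy t ht)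
    | mul x y _ _ hx hy => intro t ht; rw [mul_assoc]; exact hx _ (hy t ht)
  rw [eq_top_iff]
  intro u _
  rw [← mul_one u]
  exact key u 1 h1

namespace Ind

variable {b : LieSubalgebra ℂ g} (χ : LieAlgebra.LieCharacter ℂ b)

/-- The canonical generator `1 ⊗ 1` of a module induced from a character. -/
def gen : Ind b (CharModule χ) := (indRel b (CharModule χ)).mkQ (1 ⊗ₜ[ℂ] (1 : ℂ))

theorem mkQ_tmul (u : U g) (c : ℂ) :
    (indRel b (CharModule χ)).mkQ (u ⊗ₜ[ℂ] c) = c • u • gen χ := by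
  have h : (u ⊗ₜ[ℂ] c : U g ⊗[ℂ] CharModule χ) = c • u • ((1 : U g) ⊗ₜ[ℂ] (1 : ℂ)) := by
    rw [TensorProduct.smul_tmul', smul_eq_mul, mul_one, ← TensorProduct.tmul_smul]
    congr 1
    exact (mul_one c).symm
  rw [h]
  rfl

theorem lie_gen (x : b) : ⁅(x : g), gen χ⁆ = χ x • gen χ := by
  have h : ((1 : U g) * toU (x : g)) ⊗ₜ[ℂ] (1 : ℂ) - (1 : U g) ⊗ₜ[ℂ] (χ x • (1 : ℂ)) ∈
      indRel b (CharModule χ) := Submodule.subset_span ⟨1, x, (1 : ℂ), rfl⟩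
  rw [one_mul] at h
  have h2 := (Submodule.Quotient.eq _).2 h
  have h3 : toU (x : g) • gen χ = (indRel b (CharModule χ)).mkQ ((toU (x : g)) ⊗ₜ[ℂ] (1 : ℂ)) := by
    rw [mkQ_tmul, one_smul]
  rw [lie_def, h3]
  refine h2.trans ?_
  refine (mkQ_tmul χ 1 (χ x • (1 : ℂ))).trans ?_
  rw [one_smul, smul_eq_mul, mul_one]

variable {χ} in
/-- A subspace of the induced module that contains the generator and is stable under `g` is
everything. -/
theorem eq_top_of_gen_mem {p : Submodule ℂ (Ind b (CharModule χ))} (h1 : gen χ ∈ p)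
    (h : ∀ (x : g), ∀ m ∈ p, ⁅x, m⁆ ∈ p) : p = ⊤ := by
  have hT : p.comap ((LinearMap.toSpanSingleton (U g) _ (gen χ)).restrictScalars ℂ) = ⊤ := by
    apply submodule_U_eq_top
    · change (1 : U g) • gen χ ∈ p
      rwa [one_smul]
    · intro x t ht
      change (toU x * t) • gen χ ∈ p
      rw [mul_smul]
      exact h x _ ht
  rw [eq_top_iff]
  rintro m -
  obtain ⟨t, rfl⟩ := (indRel b (CharModule χ)).mkQ_surjective m
  induction t using TensorProduct.induction_on with
  | zero => rw [map_zero]; exact p.zero_mem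
  | tmul u c =>
    rw [show (indRel b (CharModule χ)).mkQ (u ⊗ₜ[ℂ] c) = _ from mkQ_tmul χ u c]
    exact p.smul_mem _ (by
      have : u ∈ p.comap ((LinearMap.toSpanSingleton (U g) _ (gen χ)).restrictScalars ℂ) := by
        rw [hT]; trivial
      exact this)
  | add x y hx hy => rw [map_add]; exact p.add_mem hx hy

/-- The universal property of the induced module, for a representation given as a homomorphism
to an endomorphism algebra. -/
theorem exists_lift_end {M : Type} [AddCommGroup M] [Module ℂ M]
    (ρ : g →ₗ⁅ℂ⁆ Module.End ℂ M) {v : M} (hv : ∀ x : b, ρ (x : g) v = χ x • v) :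
    ∃ f : Ind b (CharModule χ) →ₗ[ℂ] M, f (gen χ) = v ∧ ∀ (x : g) m, f ⁅x, m⁆ = ρ x (f m) := by
  let R := UniversalEnvelopingAlgebra.lift ℂ ρ
  have hR : ∀ x : g, R (toU x) = ρ x := UniversalEnvelopingAlgebra.lift_ι_apply ℂ ρ
  let F : U g ⊗[ℂ] CharModule χ →ₗ[ℂ] M := TensorProduct.lift
    { toFun := fun u => LinearMap.toSpanSingleton ℂ M (R u v)
      map_add' := fun u u' => LinearMap.ext fun c => by
        change c • R (u + u') v = c • R u v + c • R u' v
        rw [map_add, LinearMap.add_apply, smul_add]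
      map_smul' := fun c u => LinearMap.ext fun c' => by
        change c' • R (c • u) v = c • c' • R u v
        rw [map_smul, LinearMap.smul_apply, smul_comm] }
  have hF : ∀ (u : U g) (c : ℂ), F (u ⊗ₜ[ℂ] c) = c • R u v := fun u c => rfl
  have hFm : ∀ (u : U g) t, F (u • t) = R u (F t) := by
    intro u t
    induction t using TensorProduct.induction_on with
    | zero => simp
    | tmul w c =>
      rw [TensorProduct.smul_tmul']
      refine (hF _ _).trans ?_
      rw [show F (w ⊗ₜ[ℂ] c) = _ from hF w c, smul_eq_mul, map_mul, Module.End.mul_apply]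
      exact (map_smul (R u) (show ℂ from c) (R w v)).symm
    | add x y hx hy => rw [smul_add, map_add, hx, hy, map_add, map_add]
  have hker : ∀ t ∈ indRel b (CharModule χ), F t = 0 := by
    intro t ht
    induction ht using Submodule.span_induction with
    | mem t ht =>
      obtain ⟨u, x, c, rfl⟩ := ht
      rw [map_sub, sub_eq_zero]
      refine (hF _ _).trans (Eq.trans ?_ (hF _ (χ x • c)).symm)
      rw [map_mul, Module.End.mul_apply, hR, hv, map_smul]
      exact (smul_comm (show ℂ from c) (χ x) (R u v)).trans
        (smul_assoc (χ x) (show ℂ from c) (R u v)).symm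
    | zero => exact map_zero F
    | add x y _ _ hx hy => rw [map_add, hx, hy, add_zero]
    | smul u t _ ht => rw [hFm, ht, map_zero]
  let f : Ind b (CharModule χ) →ₗ[ℂ] M :=
    (Submodule.liftQ ((indRel b (CharModule χ)).restrictScalars ℂ) F hker) ∘ₗ
      (Submodule.Quotient.restrictScalarsEquiv ℂ (indRel b (CharModule χ))).symm.toLinearMap
  have hf : ∀ t, f ((indRel b (CharModule χ)).mkQ t) = F t := fun t => rfl
  refine ⟨f, ?_, ?_⟩
  · refine (hf _).trans ((hF _ _).trans ?_)
    rw [map_one, one_smul, Module.End.one_apply]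
  · intro x m
    obtain ⟨t, rfl⟩ := (indRel b (CharModule χ)).mkQ_surjective m
    refine (hf (toU x • t)).trans ?_
    rw [hFm, hR]
    rfl

/-- The universal property of the induced module. -/
theorem exists_lift {M : Type} [AddCommGroup M] [Module ℂ M] [LieRingModule g M]
    [LieModule ℂ g M] {v : M} (hv : ∀ x : b, ⁅(x : g), v⁆ = χ x • v) :
    ∃ f : Ind b (CharModule χ) →ₗ⁅ℂ, g⁆ M, f (gen χ) = v := by
  obtain ⟨f, h1, h2⟩ := exists_lift_end χ (LieModule.toEnd ℂ g M) hv
  exact ⟨{ f with map_lie' := fun {x m} => h2 x m }, h1⟩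

variable {χ} in
theorem hom_ext {M : Type} [AddCommGroup M] [Module ℂ M] [LieRingModule g M]
    {f f' : Ind b (CharModule χ) →ₗ⁅ℂ, g⁆ M} (h : f (gen χ) = f' (gen χ)) :
    f = f' := by
  have hp : LinearMap.eqLocus (f : Ind b (CharModule χ) →ₗ[ℂ] M)
      (f' : Ind b (CharModule χ) →ₗ[ℂ] M) = ⊤ := by
    apply eq_top_of_gen_mem h
    intro x m hm
    change f ⁅x, m⁆ = f' ⁅x, m⁆
    rw [LieModuleHom.map_lie, LieModuleHom.map_lie, show f m = f' m from hm]
  ext m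
  have : m ∈ LinearMap.eqLocus (f : Ind b (CharModule χ) →ₗ[ℂ] M)
      (f' : Ind b (CharModule χ) →ₗ[ℂ] M) := by rw [hp]; trivial
  exact this

/-- If `g = a + b`, then a module induced from a character of `b` is generated by its canonical
generator as an `a`-module. -/
theorem eq_top_of_stable {a : LieSubalgebra ℂ g} (hab : a.toSubmodule ⊔ b.toSubmodule = ⊤)
    {p : Submodule ℂ (Ind b (CharModule χ))} (h1 : gen χ ∈ p)
    (h : ∀ x ∈ a, ∀ m ∈ p, ⁅x, m⁆ ∈ p) : p = ⊤ := by
  -- `sInf C` is the smallest `a`-stable subspace containing the generator; it suffices to show that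
  -- it is stable under all of `g`.
  let C : Set (Submodule ℂ (Ind b (CharModule χ))) :=
    {q | gen χ ∈ q ∧ ∀ x ∈ a, ∀ m ∈ q, ⁅x, m⁆ ∈ q}
  have hC : ∀ x ∈ a, ∀ m ∈ sInf C, ⁅x, m⁆ ∈ sInf C := by
    intro x hx m hm
    rw [Submodule.mem_sInf] at hm ⊢
    exact fun q hq => hq.2 x hx m (hm q hq)
  have hgen : gen χ ∈ sInf C := (Submodule.mem_sInf).2 fun q hq => hq.1
  -- The vectors of `sInf C` that `g` sends into `sInf C`. By `y(xm) = [y,x]m + x(ym)` this subspace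
  -- is again `a`-stable, so minimality gives `sInf C ≤ T`.
  let T : Submodule ℂ (Ind b (CharModule χ)) :=
    sInf C ⊓ ⨅ y : g, (sInf C).comap (LieModule.toEnd ℂ g _ y)
  have hTmem : ∀ m, m ∈ T ↔ m ∈ sInf C ∧ ∀ y : g, ⁅y, m⁆ ∈ sInf C := by
    intro m
    simp [T]
  have hT : T ∈ C := by
    refine ⟨(hTmem _).2 ⟨hgen, fun y => ?_⟩, fun x hx m hm => ?_⟩
    · have hy : y ∈ a.toSubmodule ⊔ b.toSubmodule := by rw [hab]; trivial
      obtain ⟨x, hx, z, hz, rfl⟩ := Submodule.mem_sup.1 hy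
      rw [add_lie]
      refine Submodule.add_mem _ (hC x hx _ hgen) ?_
      rw [show ⁅z, gen χ⁆ = _ from lie_gen χ ⟨z, hz⟩]
      exact Submodule.smul_mem _ _ hgen
    · rw [hTmem] at hm ⊢
      refine ⟨hm.2 x, fun y => ?_⟩
      rw [leibniz_lie]
      exact Submodule.add_mem _ (hm.2 _) (hC x hx _ (hm.2 y))
  have hle : sInf C ≤ T := sInf_le hT
  have htop : sInf C = ⊤ := eq_top_of_gen_mem hgen fun x m hm => ((hTmem m).1 (hle hm)).2 x
  rw [eq_top_iff, ← htop]
  exact sInf_le ⟨h1, h⟩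

end Ind

/-- If `g = a ⊕ b`, then the representation of `g` on `U(a)` induced from a character of `b`. -/
theorem exists_action_U (a b : LieSubalgebra ℂ g) (hab : IsCompl a.toSubmodule b.toSubmodule)
    (β : LieAlgebra.LieCharacter ℂ b) :
    ∃ ρ : g →ₗ⁅ℂ⁆ Module.End ℂ (U a), (∀ y : b, ρ (y : g) 1 = β y • (1 : U a)) ∧
      ∀ (x : a) (t : U a), ρ (x : g) t = toU x * t := by
  -- The required action must satisfy `ρ(y)(xt) = x ρ(y)t - ρ([x,y])t`. Read as a recursion for the
  -- map `P_t : y ↦ ρ(y)t`, this says `P_{xt} = Q₀ x P_t`. Since `Q₀` is a representation of `a`, it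
  -- extends to `U a`, and `P_t` can be defined as the action of `t` on `P₁`.
  let Q₀ : a → Module.End ℂ (g →ₗ[ℂ] U a) := fun x =>
    { toFun := fun P => LinearMap.mulLeft ℂ (toU x) ∘ₗ P - P ∘ₗ (LieAlgebra.ad ℂ g (x : g))
      map_add' := fun P P' => by ext; simp [mul_add]; abel
      map_smul' := fun c P => by ext; simp [smul_sub] }
  have hQ₀ : ∀ x P y, Q₀ x P y = toU x * P y - P ⁅(x : g), y⁆ := fun x P y => rfl
  let Q : a →ₗ⁅ℂ⁆ Module.End ℂ (g →ₗ[ℂ] U a) :=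
    { toFun := Q₀
      map_add' := fun x x' => by
        ext P y
        have h : ⁅((x + x' : a) : g), y⁆ = ⁅(x : g), y⁆ + ⁅(x' : g), y⁆ := add_lie _ _ _
        simp only [hQ₀, LinearMap.add_apply, toU, map_add, add_mul, h, map_add]
        abel
      map_smul' := fun c x => by
        ext P y
        have h : ⁅((c • x : a) : g), y⁆ = c • ⁅(x : g), y⁆ := smul_lie _ _ _
        simp only [hQ₀, LinearMap.smul_apply, toU, map_smul, RingHom.id_apply, smul_mul_assoc,
          h, map_smul, smul_sub]
      map_lie' := fun {x x'} => by
        ext P y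
        simp only [hQ₀, LieRing.of_associative_ring_bracket, LinearMap.sub_apply,
          Module.End.mul_apply, toU, LieHom.map_lie, LieSubalgebra.coe_bracket, lie_lie, map_sub,
          sub_mul, mul_sub, mul_assoc]
        abel }
  let R := UniversalEnvelopingAlgebra.lift ℂ Q
  have hR : ∀ x : a, R (toU x) = Q₀ x := UniversalEnvelopingAlgebra.lift_ι_apply ℂ Q
  -- The initial value `y ↦ ρ(y)1`: the canonical map on `a`, the character `β` on `b`.
  let P₁ : g →ₗ[ℂ] U a := LinearMap.ofIsCompl hab
    (UniversalEnvelopingAlgebra.ι ℂ : a →ₗ⁅ℂ⁆ U a).toLinearMap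
    (LinearMap.toSpanSingleton ℂ (U a) 1 ∘ₗ (β : b →ₗ[ℂ] ℂ))
  have hPa : ∀ x : a, P₁ (x : g) = toU x := fun x => LinearMap.ofIsCompl_apply_left hab x
  have hPb : ∀ y : b, P₁ (y : g) = β y • (1 : U a) := fun y => LinearMap.ofIsCompl_apply_right hab y
  let ρ₀ : g →ₗ[ℂ] Module.End ℂ (U a) :=
    LinearMap.flip ((LinearMap.applyₗ P₁) ∘ₗ R.toLinearMap)
  have hρ : ∀ y t, ρ₀ y t = R t P₁ y := fun y t => rfl
  have hρ1 : ∀ y, ρ₀ y 1 = P₁ y := fun y => by rw [hρ, map_one, Module.End.one_apply]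
  have hρm : ∀ (y : g) (x : a) (t : U a), ρ₀ y (toU x * t) = toU x * ρ₀ y t - ρ₀ ⁅(x : g), y⁆ t := by
    intro y x t
    rw [hρ, map_mul, Module.End.mul_apply, hR, hQ₀, hρ, hρ]
  have hρa : ∀ (t : U a) (x : a), ρ₀ (x : g) t = toU x * t := by
    let T : Submodule ℂ (U a) :=
      ⨅ x : a, LinearMap.eqLocus (ρ₀ (x : g)) (LinearMap.mulLeft ℂ (toU x))
    have hTm : ∀ t, t ∈ T ↔ ∀ x : a, ρ₀ (x : g) t = toU x * t := by
      intro t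
      rw [Submodule.mem_iInf]
      rfl
    have hT : T = ⊤ := by
      refine submodule_U_eq_top ((hTm _).2 fun x => by rw [hρ1, hPa, mul_one]) ?_
      intro x' t ht
      rw [hTm] at ht ⊢
      intro x
      rw [hρm, ht, ← LieSubalgebra.coe_bracket, ht]
      simp only [toU, LieHom.map_lie, LieRing.of_associative_ring_bracket, sub_mul, mul_assoc]
      abel
    intro t
    exact (hTm t).1 (by rw [hT]; trivial)
  -- The recursion and the Jacobi identity carry the bracket relation from `t` to `xt`. If one
  -- argument lies in `a`, the relation is the recursion itself. At `t = 1` this leaves two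
  -- arguments in `b`, where both sides vanish because `β` kills brackets.
  have hρlie : ∀ (t : U a) (y z : g), ρ₀ ⁅y, z⁆ t = ρ₀ y (ρ₀ z t) - ρ₀ z (ρ₀ y t) := by
    let T : Submodule ℂ (U a) :=
      ⨅ (y : g) (z : g), LinearMap.eqLocus (ρ₀ ⁅y, z⁆) (ρ₀ y * ρ₀ z - ρ₀ z * ρ₀ y)
    have hTm : ∀ t, t ∈ T ↔ ∀ y z : g, ρ₀ ⁅y, z⁆ t = ρ₀ y (ρ₀ z t) - ρ₀ z (ρ₀ y t) := by
      intro t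
      simp only [T, Submodule.mem_iInf]
      rfl
    have hleft : ∀ (x : a) (t : U a) (z : g),
        ρ₀ ⁅(x : g), z⁆ t = ρ₀ (x : g) (ρ₀ z t) - ρ₀ z (ρ₀ (x : g) t) := by
      intro x t z
      rw [hρa, hρa, hρm]
      abel
    have hT : T = ⊤ := by
      refine submodule_U_eq_top ((hTm _).2 fun y z => ?_) ?_
      · have hdec : ∀ y : g, ∃ (x : a) (y' : b), (x : g) + (y' : g) = y := by
          intro y
          have hy : y ∈ a.toSubmodule ⊔ b.toSubmodule := by rw [hab.sup_eq_top]; trivial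
          obtain ⟨x, hx, z, hz, h⟩ := Submodule.mem_sup.1 hy
          exact ⟨⟨x, hx⟩, ⟨z, hz⟩, h⟩
        obtain ⟨x, y, rfl⟩ := hdec y
        rw [add_lie, map_add, LinearMap.add_apply, hleft, map_add, LinearMap.add_apply,
          LinearMap.add_apply, map_add, add_sub_add_comm]
        congr 1
        obtain ⟨x', z, rfl⟩ := hdec z
        have h1 := hleft x' 1 (y : g)
        rw [← lie_skew, map_neg, LinearMap.neg_apply, neg_eq_iff_eq_neg, neg_sub] at h1
        have h2 : ρ₀ ⁅(y : g), (z : g)⁆ 1 = ρ₀ (y : g) (ρ₀ (z : g) 1) - ρ₀ (z : g) (ρ₀ (y : g) 1) := by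
          rw [← LieSubalgebra.coe_bracket, hρ1, hρ1, hρ1, hPb, hPb, hPb, map_smul, map_smul, hρ1,
            hρ1, hPb, hPb, LieAlgebra.lieCharacter_apply_lie, zero_smul, smul_comm, sub_self]
        rw [lie_add, map_add, LinearMap.add_apply, h1, h2, map_add, LinearMap.add_apply,
          LinearMap.add_apply, map_add]
        abel
      · intro x t ht
        rw [hTm] at ht ⊢
        intro y z
        rw [hρm, hρm, hρm, map_sub, map_sub, hρm, hρm, leibniz_lie, map_add, LinearMap.add_apply,
          ht y z, ht _ z, ht y, mul_sub]
        abel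
    intro t
    exact (hTm t).1 (by rw [hT]; trivial)
  refine ⟨{ ρ₀ with map_lie' := fun {y z} => ?_ }, fun y => ?_, fun x t => hρa t x⟩
  · ext t
    exact hρlie t y z
  · exact (hρ1 _).trans (hPb y)

/-- If `g = a ⊕ b`, then a module induced from a character of `b` has, for each character of `a`,
a normalized linear form that transforms under `a` by this character. -/
theorem Ind.exists_functional {a b : LieSubalgebra ℂ g}
    (hab : IsCompl a.toSubmodule b.toSubmodule) (β : LieAlgebra.LieCharacter ℂ b)
    (α : LieAlgebra.LieCharacter ℂ a) :
    ∃ F : Ind b (CharModule β) →ₗ[ℂ] ℂ, F (gen β) = 1 ∧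
      ∀ (x : a) m, F ⁅(x : g), m⁆ = α x * F m := by
  obtain ⟨ρ, h1, h2⟩ := exists_action_U a b hab β
  obtain ⟨f, hf1, hf2⟩ := Ind.exists_lift_end β ρ h1
  -- The induced module maps to `U a` with the generator going to `1`, and `α` extends to an algebra
  -- homomorphism `U a → ℂ`.
  refine ⟨(UniversalEnvelopingAlgebra.lift ℂ α).toLinearMap ∘ₗ f, ?_, fun x m => ?_⟩
  · simp [hf1]
  · rw [LinearMap.comp_apply, hf2, h2]
    simp only [AlgHom.toLinearMap_apply, map_mul, toU, LinearMap.comp_apply]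
    rw [UniversalEnvelopingAlgebra.lift_ι_apply]

end General

theorem lie_mem_of_mem_span_left {g V : Type} [LieRing g] [LieAlgebra ℂ g] [AddCommGroup V]
    [Module ℂ V] [LieRingModule g V] [LieModule ℂ g V] {T : Set g} {P : Submodule ℂ V} {v : V}
    (h : ∀ x ∈ T, ⁅x, v⁆ ∈ P) {x : g} (hx : x ∈ Submodule.span ℂ T) : ⁅x, v⁆ ∈ P := by
  induction hx using Submodule.span_induction with
  | mem x hx => exact h x hx
  | zero => rw [zero_lie]; exact Submodule.zero_mem _
  | add x y _ _ h1 h2 => rw [add_lie]; exact Submodule.add_mem _ h1 h2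
  | smul c x _ h1 => rw [smul_lie]; exact Submodule.smul_mem _ _ h1

section Word

variable {g V : Type} [LieRing g] [AddCommGroup V] [LieRingModule g V]

/-- The vector `x₁ x₂ ⋯ xₖ w` for a list of indices of elements of `g`. -/
def word {ι : Type} (D : ι → g) (w : V) (l : List ι) : V := l.foldr (fun p v => ⁅D p, v⁆) w

theorem word_nil {ι : Type} (D : ι → g) (w : V) : word D w [] = w := rfl

theorem word_cons {ι : Type} (D : ι → g) (w : V) (p : ι) (l : List ι) :
    word D w (p :: l) = ⁅D p, word D w l⁆ := rfl

end Word

/-! ### Duals, annihilators and Whittaker vectors -/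

section Dual

variable {g : Type} [LieRing g] [LieAlgebra ℂ g]

/-- The action of `U(g)` on a `g`-module. -/
abbrev actU (M : Type) [AddCommGroup M] [Module ℂ M] [LieRingModule g M] [LieModule ℂ g M] :
    U g →ₐ[ℂ] Module.End ℂ M :=
  UniversalEnvelopingAlgebra.lift ℂ (LieModule.toEnd ℂ g M)

section

variable {M N : Type} [AddCommGroup M] [Module ℂ M] [LieRingModule g M] [LieModule ℂ g M]
  [AddCommGroup N] [Module ℂ N] [LieRingModule g N] [LieModule ℂ g N]

theorem actU_toU_mul (x : g) (u : U g) (m : M) : actU M (toU x * u) m = ⁅x, actU M u m⁆ := by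
  rw [map_mul, Module.End.mul_apply]
  exact LinearMap.congr_fun
    (UniversalEnvelopingAlgebra.lift_ι_apply ℂ (LieModule.toEnd ℂ g M) x) (actU M u m)

theorem map_actU (f : M →ₗ⁅ℂ, g⁆ N) (u : U g) (m : M) : f (actU M u m) = actU N u (f m) := by
  let T : Submodule ℂ (U g) := LinearMap.eqLocus
    ((f : M →ₗ[ℂ] N) ∘ₗ LinearMap.applyₗ m ∘ₗ (actU M).toLinearMap)
    (LinearMap.applyₗ (f m) ∘ₗ (actU N).toLinearMap)
  have hTm : ∀ u, u ∈ T ↔ f (actU M u m) = actU N u (f m) := fun u => Iff.rfl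
  have hT : T = ⊤ := by
    refine submodule_U_eq_top ?_ fun x t ht => ?_
    · rw [hTm, map_one, map_one, Module.End.one_apply, Module.End.one_apply]
    · rw [hTm] at ht ⊢
      rw [actU_toU_mul, actU_toU_mul, LieModuleHom.map_lie, ht]
  exact (hTm u).1 (by rw [hT]; trivial)

variable (M) in
/-- Each element of `U(g)` acts on the dual of a `g`-module by a transposed endomorphism. -/
theorem exists_transpose_actU (u : U g) :
    ∃ T : Module.End ℂ M, ∀ (F : Module.Dual ℂ M) m, actU (Module.Dual ℂ M) u F m = F (T m) := by
  let S : Submodule ℂ (U g) :=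
    { carrier := {u | ∃ T : Module.End ℂ M, ∀ (F : Module.Dual ℂ M) m,
        actU (Module.Dual ℂ M) u F m = F (T m)}
      add_mem' := by
        rintro u u' ⟨T, hT⟩ ⟨T', hT'⟩
        refine ⟨T + T', fun F m => ?_⟩
        rw [map_add, LinearMap.add_apply, LinearMap.add_apply, LinearMap.add_apply, map_add, hT,
          hT']
      zero_mem' := ⟨0, fun F m => by simp⟩
      smul_mem' := by
        rintro c u ⟨T, hT⟩
        refine ⟨c • T, fun F m => ?_⟩
        rw [map_smul, LinearMap.smul_apply, LinearMap.smul_apply, LinearMap.smul_apply, map_smul,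
          hT] }
  have hS : S = ⊤ := by
    refine submodule_U_eq_top ⟨1, fun F m => by simp⟩ ?_
    rintro x u ⟨T, hT⟩
    -- `(x(uF))(m) = -(uF)(xm) = -F(T(xm))`: transposition reverses products and changes the sign on
    -- `g`.
    refine ⟨-(T * LieModule.toEnd ℂ g M x), fun F m => ?_⟩
    rw [actU_toU_mul, Module.Dual.lie_apply, hT]
    simp
  have : u ∈ S := by rw [hS]; trivial
  exact this

/-- Two modules that are in separating duality with the same module have the same annihilator. -/
theorem annihilator_eq_of_dual {X Y : Type} [AddCommGroup X] [Module ℂ X] [LieRingModule g X]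
    [LieModule ℂ g X] [AddCommGroup Y] [Module ℂ Y] [LieRingModule g Y] [LieModule ℂ g Y]
    (f : X →ₗ⁅ℂ, g⁆ Module.Dual ℂ M) (hf : Function.Injective f)
    (hf' : ∀ m, (∀ x, f x m = 0) → m = 0)
    (f' : Y →ₗ⁅ℂ, g⁆ Module.Dual ℂ M) (hg : Function.Injective f')
    (hg' : ∀ m, (∀ x, f' x m = 0) → m = 0) : annihilator g X = annihilator g Y := by
  -- Separation of the points of `M` gives one direction and injectivity into the dual gives the
  -- other, so membership in the annihilator depends only on the transpose `T`.
  have key : ∀ {Z : Type} [AddCommGroup Z] [Module ℂ Z] [LieRingModule g Z] [LieModule ℂ g Z]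
      (f : Z →ₗ⁅ℂ, g⁆ Module.Dual ℂ M), Function.Injective f →
      (∀ m, (∀ x, f x m = 0) → m = 0) → ∀ (u : U g) (T : Module.End ℂ M),
      (∀ (F : Module.Dual ℂ M) m, actU (Module.Dual ℂ M) u F m = F (T m)) →
      (u ∈ annihilator g Z ↔ T = 0) := by
    intro Z _ _ _ _ f hf hf' u T hT
    have h1 : u ∈ annihilator g Z ↔ ∀ z, actU Z u z = 0 := by
      rw [annihilator, RingHom.mem_ker, LinearMap.ext_iff]
      rfl
    rw [h1]
    constructor
    · intro h
      ext m
      refine hf' _ fun z => ?_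
      rw [← hT, ← map_actU, h, map_zero, LinearMap.zero_apply]
    · intro h z
      apply hf
      rw [map_actU, map_zero]
      ext m
      rw [hT, h, LinearMap.zero_apply, map_zero, LinearMap.zero_apply]
  ext u
  obtain ⟨T, hT⟩ := exists_transpose_actU M u
  rw [key f hf hf' u T hT, key f' hg hg' u T hT]

/-- A nonzero homomorphism to the dual of a simple module separates points. -/
theorem eq_zero_of_forall_dual_apply_eq_zero {N : Type} [AddCommGroup N] [Module ℂ N]
    [LieRingModule g N] [LieModule.IsIrreducible ℂ g M] (f : N →ₗ⁅ℂ, g⁆ Module.Dual ℂ M)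
    (hf : f ≠ 0) {m : M} (hm : ∀ x, f x m = 0) : m = 0 := by
  -- The radical of the pairing in `M` is a submodule, so it is zero or everything; the latter would
  -- force `f = 0`.
  let K : LieSubmodule ℂ g M :=
    { carrier := {m | ∀ x, f x m = 0}
      add_mem' := fun {m m'} hm hm' x => by rw [map_add, hm x, hm' x, add_zero]
      zero_mem' := fun x => map_zero (f x)
      smul_mem' := fun c m hm x => by rw [map_smul, hm x, smul_zero]
      lie_mem := fun {y m} hm x => by
        have h := hm ⁅y, x⁆
        rwa [LieModuleHom.map_lie, Module.Dual.lie_apply, neg_eq_zero] at h }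
  rcases eq_bot_or_eq_top K with h | h
  · have : m ∈ K := hm
    rwa [h, LieSubmodule.mem_bot] at this
  · exfalso
    apply hf
    ext x m
    have : m ∈ K := by rw [h]; trivial
    exact this x

end

section Whittaker

variable {a b : LieSubalgebra ℂ g}

theorem mem_whittaker {χ : LieAlgebra.LieCharacter ℂ a} {M : Type} [AddCommGroup M] [Module ℂ M]
    [LieRingModule g M] [LieModule ℂ g M] {v : M} :
    v ∈ whittaker χ M ↔ ∀ x : a, ⁅(x : g), v⁆ = χ x • v := Iff.rfl

/-- If `g = a ⊕ b`, the dual of a module induced from a character of `b` has a unique line of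
Whittaker vectors for each character of `a`. -/
theorem exists_whittaker_dual (hab : IsCompl a.toSubmodule b.toSubmodule)
    (β : LieAlgebra.LieCharacter ℂ b) (χ : LieAlgebra.LieCharacter ℂ a) :
    ∃ F ∈ whittaker χ (Module.Dual ℂ (Ind b (CharModule β))), F (Ind.gen β) = 1 ∧
      ∀ F' ∈ whittaker χ (Module.Dual ℂ (Ind b (CharModule β))), F' = F' (Ind.gen β) • F := by
  -- The dual action carries a sign, so a form of type `χ` transforms by `-χ` under the action on
  -- its argument.
  let α : LieAlgebra.LieCharacter ℂ a :=
    { toLinearMap := -(χ : a →ₗ[ℂ] ℂ)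
      map_lie' := fun {x y} => by
        change -χ ⁅x, y⁆ = ⁅-χ x, -χ y⁆
        rw [LieAlgebra.lieCharacter_apply_lie, LieRing.of_associative_ring_bracket, neg_zero,
          mul_comm, sub_self] }
  have hα : ∀ x, α x = -χ x := fun x => rfl
  obtain ⟨F, h1, h2⟩ := Ind.exists_functional hab β α
  have hF : F ∈ whittaker χ (Module.Dual ℂ (Ind b (CharModule β))) := by
    intro x
    ext m
    change -F ⁅(x : g), m⁆ = χ x • F m
    rw [h2, hα, neg_mul, neg_neg, smul_eq_mul]
  refine ⟨F, hF, h1, fun F' hF' => ?_⟩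
  have hG := (whittaker χ (Module.Dual ℂ (Ind b (CharModule β)))).sub_mem hF'
    ((whittaker χ (Module.Dual ℂ (Ind b (CharModule β)))).smul_mem (F' (Ind.gen β)) hF)
  rw [← sub_eq_zero]
  set G := F' - F' (Ind.gen β) • F with hGdef
  have hG1 : G (Ind.gen β) = 0 := by
    rw [hGdef, LinearMap.sub_apply, LinearMap.smul_apply, h1, smul_eq_mul, mul_one, sub_self]
  -- The kernel of a Whittaker form is `a`-stable; here it contains the generator, hence everything.
  have hker : LinearMap.ker G = ⊤ := by
    refine Ind.eq_top_of_stable β hab.sup_eq_top hG1 fun x hx m hm => ?_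
    have h := LinearMap.congr_fun (hG ⟨x, hx⟩) m
    change -G ⁅x, m⁆ = χ ⟨x, hx⟩ • G m at h
    rw [LinearMap.mem_ker] at hm ⊢
    rwa [hm, smul_zero, neg_eq_zero] at h
  exact LinearMap.ker_eq_top.1 hker

variable {V : Type} [AddCommGroup V] [Module ℂ V] [LieRingModule g V] [LieModule ℂ g V]

/-- If the elements of `a` act on `g` by lowering a nonnegative degree, then each nonzero submodule
of a module generated by a Whittaker vector contains a nonzero Whittaker vector. -/
theorem exists_mem_whittaker {ι : Type} {D : ι → g} (hD : Submodule.span ℂ (Set.range D) = ⊤)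
    {d : ι → ℕ} (hd : ∀ (x : a) p, ⁅(x : g), D p⁆ ∈ Submodule.span ℂ (D '' {q | d q < d p}))
    {χ : LieAlgebra.LieCharacter ℂ a} {w : V} (hw : w ∈ whittaker χ V)
    (hgen : ∀ N : LieSubmodule ℂ g V, w ∈ N → N = ⊤) {N : LieSubmodule ℂ g V} (hN : N ≠ ⊥) :
    ∃ v ∈ N, v ≠ 0 ∧ v ∈ whittaker χ V := by
  -- The strict inequality makes `G 0` zero and puts `w`, the empty word, into `G 1`.
  let G : ℕ → Submodule ℂ V := fun k =>
    Submodule.span ℂ (word D w '' {l | (l.map d).sum < k})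
  have hword : ∀ {l : List ι} {k : ℕ}, (l.map d).sum < k → word D w l ∈ G k := fun {l k} h =>
    Submodule.subset_span ⟨l, h, rfl⟩
  have hmono : Monotone G := fun k k' h => Submodule.span_mono
    (Set.image_mono fun l hl => lt_of_lt_of_le hl h)
  have hDG : ∀ p k, ∀ v ∈ G k, ⁅D p, v⁆ ∈ G (d p + k) := by
    intro p k v hv
    induction hv using Submodule.span_induction with
    | mem v hv =>
      obtain ⟨l, hl, rfl⟩ := hv
      rw [← word_cons]
      apply hword
      rw [List.map_cons, List.sum_cons]
      exact Nat.add_lt_add_left hl _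
    | zero => rw [lie_zero]; exact Submodule.zero_mem _
    | add v v' _ _ h h' => rw [lie_add]; exact Submodule.add_mem _ h h'
    | smul c v _ h => rw [lie_smul]; exact Submodule.smul_mem _ _ h
  -- Moving `x` to the right through a word replaces one letter at a time by letters of smaller
  -- degree; once `x` reaches `w` it acts by `χ x`.
  have hlow : ∀ (x : a) l, ⁅(x : g), word D w l⁆ - χ x • word D w l ∈ G (l.map d).sum := by
    intro x l
    induction l with
    | nil => rw [word_nil, mem_whittaker.1 hw x, sub_self]; exact Submodule.zero_mem _
    | cons p l ih =>
      have h1 : ∀ y ∈ Submodule.span ℂ (D '' {q | d q < d p}),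
          ⁅y, word D w l⁆ ∈ G ((p :: l).map d).sum := by
        refine fun y hy => lie_mem_of_mem_span_left ?_ hy
        rintro _ ⟨q, hq, rfl⟩
        rw [← word_cons]
        apply hword
        simpa using hq
      have h2 := hDG p _ _ ih
      have h3 : ⁅(x : g), word D w (p :: l)⁆ - χ x • word D w (p :: l) =
          ⁅⁅(x : g), D p⁆, word D w l⁆ + ⁅D p, ⁅(x : g), word D w l⁆ - χ x • word D w l⁆ := by
        rw [word_cons, leibniz_lie, lie_sub, lie_smul]
        abel
      rw [h3]
      refine Submodule.add_mem _ (h1 _ (hd x p)) ?_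
      rwa [List.map_cons, List.sum_cons]
  have hlow' : ∀ (x : a) k, ∀ v ∈ G (k + 1), ⁅(x : g), v⁆ - χ x • v ∈ G k := by
    intro x k v hv
    induction hv using Submodule.span_induction with
    | mem v hv =>
      obtain ⟨l, hl, rfl⟩ := hv
      exact hmono (Nat.lt_succ_iff.1 hl) (hlow x l)
    | zero => rw [lie_zero, smul_zero, sub_zero]; exact Submodule.zero_mem _
    | add v v' _ _ h h' =>
      rw [lie_add, smul_add, add_sub_add_comm]
      exact Submodule.add_mem _ h h'
    | smul c v _ h =>
      rw [lie_smul, smul_comm, ← smul_sub]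
      exact Submodule.smul_mem _ _ h
  let T : LieSubmodule ℂ g V :=
    { carrier := {v | ∃ k, v ∈ G k}
      add_mem' := by
        rintro v v' ⟨k, hk⟩ ⟨k', hk'⟩
        exact ⟨max k k', Submodule.add_mem _ (hmono (le_max_left _ _) hk)
          (hmono (le_max_right _ _) hk')⟩
      zero_mem' := ⟨0, Submodule.zero_mem _⟩
      smul_mem' := by
        rintro c v ⟨k, hk⟩
        exact ⟨k, Submodule.smul_mem _ _ hk⟩
      lie_mem := by
        rintro y v ⟨k, hk⟩
        have hy : y ∈ Submodule.span ℂ (Set.range D) := by rw [hD]; trivial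
        change ∃ k, ⁅y, v⁆ ∈ G k
        induction hy using Submodule.span_induction with
        | mem y hy => obtain ⟨p, rfl⟩ := hy; exact ⟨_, hDG p k v hk⟩
        | zero => exact ⟨0, by rw [zero_lie]; exact Submodule.zero_mem _⟩
        | add y y' _ _ h h' =>
          obtain ⟨k, hk⟩ := h
          obtain ⟨k', hk'⟩ := h'
          rw [add_lie]
          exact ⟨max k k', Submodule.add_mem _ (hmono (le_max_left _ _) hk)
            (hmono (le_max_right _ _) hk')⟩
        | smul c y _ h =>
          obtain ⟨k, hk⟩ := h
          rw [smul_lie]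
          exact ⟨k, Submodule.smul_mem _ _ hk⟩ }
  have hT : T = ⊤ := hgen T ⟨1, hword (l := []) (by simp)⟩
  have hex : ∃ k, ∃ v ∈ N, v ≠ 0 ∧ v ∈ G k := by
    obtain ⟨v, hv, hv0⟩ := N.toSubmodule.exists_mem_ne_zero_of_ne_bot (by simpa using hN)
    have hvT : v ∈ T := by rw [hT]; trivial
    obtain ⟨k, hk⟩ := hvT
    exact ⟨k, v, hv, hv0, hk⟩
  classical
  -- A nonzero vector of `N` in the smallest possible filtration step is a Whittaker vector:
  -- otherwise some `xv - χ(x)v` would be a nonzero vector of `N` one step lower.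
  obtain ⟨v, hv, hv0, hvk⟩ := Nat.find_spec hex
  refine ⟨v, hv, hv0, fun x => ?_⟩
  by_contra hne
  have hG0 : G 0 = ⊥ := by
    simp [G]
  obtain ⟨k, hk⟩ : ∃ k, Nat.find hex = k + 1 := by
    refine Nat.exists_eq_succ_of_ne_zero fun h => hv0 ?_
    rwa [h, hG0, Submodule.mem_bot] at hvk
  rw [hk] at hvk
  refine Nat.find_min hex (m := k) (by omega) ⟨⁅(x : g), v⁆ - χ x • v, ?_, ?_, hlow' x k v hvk⟩
  · exact N.sub_mem (N.lie_mem hv) (N.smul_mem _ hv)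
  · rw [sub_ne_zero]
    exact hne

/-- In the situation of `exists_mem_whittaker`, the module is simple if it has a unique line of
Whittaker vectors. -/
theorem isIrreducible_of_whittaker {ι : Type} {D : ι → g}
    (hD : Submodule.span ℂ (Set.range D) = ⊤)
    {d : ι → ℕ} (hd : ∀ (x : a) p, ⁅(x : g), D p⁆ ∈ Submodule.span ℂ (D '' {q | d q < d p}))
    {χ : LieAlgebra.LieCharacter ℂ a} {w : V} (hw : w ∈ whittaker χ V) (hw0 : w ≠ 0)
    (hgen : ∀ N : LieSubmodule ℂ g V, w ∈ N → N = ⊤)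
    (huniq : ∀ v ∈ whittaker χ V, ∃ c : ℂ, v = c • w) : LieModule.IsIrreducible ℂ g V := by
  have : Nontrivial V := ⟨w, 0, hw0⟩
  refine LieModule.IsIrreducible.mk fun N hN => hgen N ?_
  obtain ⟨v, hv, hv0, hvw⟩ := exists_mem_whittaker hD hd hw hgen hN
  obtain ⟨c, rfl⟩ := huniq v hvw
  have hc : c ≠ 0 := by rintro rfl; exact hv0 (zero_smul _ _)
  rw [← inv_smul_smul₀ hc w]
  exact N.smul_mem _ hv

end Whittaker

end Dual

/-! ### The grading and the triangular decomposition -/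

section Degree

variable {n : ℕ}

theorem span_range_D : Submodule.span ℂ (Set.range (D : Idx n → Witt n)) = ⊤ := by
  rw [← (wittBasis n).span_eq]
  congr 2
  funext p
  exact (wittBasis_apply p).symm

theorem D_linearIndependent : LinearIndependent ℂ (D : Idx n → Witt n) := by
  rw [← show ⇑(wittBasis n) = D from funext wittBasis_apply]
  exact (wittBasis n).linearIndependent

variable (r : Fin n → Fin n → Prop)

open Classical in
/-- Positive integers `c_i` that are increasing with respect to `r` and satisfy
`max c < 2 * min c`. -/
def coweight (i : Fin n) : ℕ := n + 1 + (Finset.univ.filter fun j => r j i).card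

theorem le_coweight (i : Fin n) : n + 1 ≤ coweight r i := Nat.le_add_right _ _

theorem coweight_le (i : Fin n) : coweight r i ≤ 2 * n + 1 := by
  classical
  have h := Finset.card_le_univ (Finset.univ.filter fun j => r j i)
  rw [Fintype.card_fin] at h
  unfold coweight
  convert (by omega : n + 1 + (Finset.univ.filter fun j => r j i).card ≤ 2 * n + 1)

theorem coweight_lt [IsStrictTotalOrder (Fin n) r] {i j : Fin n} (h : r i j) :
    coweight r i < coweight r j := by
  classical
  refine Nat.add_lt_add_left (Finset.card_lt_card ?_) _
  rw [Finset.ssubset_iff_of_subset]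
  · exact ⟨i, by simpa using h, by simpa using irrefl_of r i⟩
  · intro k hk
    simp only [Finset.mem_filter, Finset.mem_univ, true_and] at hk ⊢
    exact _root_.trans hk h

/-- The element `∑ c_k x_k ∂/∂x_k` of the Cartan subalgebra. -/
def gradingElt : torus n :=
  ∑ k, (coweight r k : ℂ) • ⟨D (k, e k), D_mem_spanD closed_cartanIdx rfl⟩

theorem torusCoord_D (i k : Fin n) :
    torusCoord k ⟨D (i, e i), D_mem_spanD closed_cartanIdx rfl⟩ = if i = k then 1 else 0 := by
  change (wittBasis n).coord (k, e k) (D (i, e i)) = _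
  rw [← wittBasis_apply, Module.Basis.coord_apply, Module.Basis.repr_self, Finsupp.single_apply]
  by_cases hik : i = k
  · subst hik; simp
  · simp [hik]

theorem torusCoord_gradingElt (k : Fin n) : torusCoord k (gradingElt r) = coweight r k := by
  rw [gradingElt, map_sum]
  simp_rw [map_smul, torusCoord_D]
  simp

/-- The degree of `D_i(m)` with respect to the grading element. -/
def deg (p : Idx n) : ℤ := ∑ k, (p.2 k : ℤ) * coweight r k - coweight r p.1

theorem wt_gradingElt (p : Idx n) : wt p (gradingElt r) = (deg r p : ℂ) := by
  simp [wt, deg, torusCoord_gradingElt]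

/-- Degrees are weights evaluated at the grading element. The nonvanishing exponent ensures that the
truncated subtraction of `e p.1` is a true one. -/
theorem deg_add {p q : Idx n} (h : q.2 p.1 ≠ 0) :
    deg r (q.1, p.2 + q.2 - e p.1) = deg r p + deg r q := by
  have h1 := congrArg (fun f => f (gradingElt r)) (wt_add h)
  simp only [LinearMap.add_apply, wt_gradingElt] at h1
  exact_mod_cast h1

theorem deg_e (i j : Fin n) : deg r (i, e j) = coweight r j - coweight r i := by
  simp [deg, e_apply]

/-- This bound makes the truncation `toNat` in `natDeg` harmless. -/
theorem neg_le_deg (p : Idx n) : -(2 * n + 1 : ℤ) ≤ deg r p := by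
  have h1 : (0 : ℤ) ≤ ∑ k, (p.2 k : ℤ) * coweight r k := by positivity
  have h2 := coweight_le r p.1
  unfold deg
  omega

theorem deg_of_cartan {p : Idx n} (hp : p ∈ cartanIdx n) : deg r p = 0 := by
  obtain ⟨i, m⟩ := p
  obtain rfl : m = e i := hp
  rw [deg_e, sub_self]

theorem finite_posIdx : (posIdx r).Finite := by
  refine ((Set.finite_range fun i : Fin n => ((i, 0) : Idx n)).union
    (Set.finite_range fun p : Fin n × Fin n => ((p.1, e p.2) : Idx n))).subset ?_
  rintro ⟨i, m⟩ (h | ⟨j, -, h⟩)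
  · obtain rfl : m = 0 := h
    exact Or.inl ⟨i, rfl⟩
  · obtain rfl : m = e j := h
    exact Or.inr ⟨(i, j), rfl⟩

variable [IsStrictTotalOrder (Fin n) r]

theorem deg_of_pos {p : Idx n} (hp : p ∈ posIdx r) : deg r p < 0 := by
  obtain ⟨i, m⟩ := p
  rcases hp with h | ⟨j, hj, h⟩
  · obtain rfl : m = 0 := h
    have := le_coweight r i
    simp only [deg, Finsupp.coe_zero, Pi.zero_apply, Nat.cast_zero, zero_mul, Finset.sum_const_zero]
    omega
  · obtain rfl : m = e j := h
    have := coweight_lt r hj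
    rw [deg_e]
    simp only at this
    omega

/-- A monomial of total degree at least two contributes at least `2 * (n + 1)`, which exceeds every
coweight, these being at most `2 * n + 1`. The root vectors of `𝔤𝔩ₙ` are handled by the monotonicity
of the coweights. -/
theorem deg_of_neg {p : Idx n} (hp : p ∈ negIdx r) : 0 < deg r p := by
  obtain ⟨i, m⟩ := p
  rcases hp with ⟨j, hj, h⟩ | h
  · obtain rfl : m = e j := h
    have := coweight_lt r hj
    rw [deg_e]
    simp only at this
    omega
  · have h1 : ((n : ℤ) + 1) * m.degree ≤ ∑ k, (m k : ℤ) * coweight r k := by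
      rw [Finsupp.degree_eq_sum, Nat.cast_sum, Finset.mul_sum]
      refine Finset.sum_le_sum fun k _ => ?_
      have := le_coweight r k
      rw [mul_comm]
      gcongr
      exact_mod_cast this
    have h2 : (2 : ℤ) ≤ m.degree := by exact_mod_cast h
    have h3 := coweight_le r i
    have h4 : ((n : ℤ) + 1) * 2 ≤ (n + 1) * m.degree := by gcongr
    simp only [deg]
    omega

theorem mem_posIdx_or (p : Idx n) : p ∈ posIdx r ∨ p ∈ cartanIdx n ∨ p ∈ negIdx r := by
  obtain ⟨i, m⟩ := p
  rcases Nat.lt_or_ge m.degree 2 with h | h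
  · by_cases h0 : m = 0
    · exact Or.inl (Or.inl h0)
    · have h1 : m.degree = 1 := by
        have : m.degree ≠ 0 := by rwa [ne_eq, Finsupp.degree_eq_zero_iff]
        omega
      obtain ⟨j, rfl⟩ : ∃ j, m = e j := by
        obtain ⟨j, hj⟩ := Finsupp.ne_iff.1 h0
        obtain ⟨k, rfl⟩ := eq_e_add hj
        rw [map_add, degree_e, Nat.add_eq_left, Finsupp.degree_eq_zero_iff] at h1
        exact ⟨j, by rw [h1, add_zero]⟩
      rcases trichotomous_of r i j with h | rfl | h
      · exact Or.inr (Or.inr (Or.inl ⟨j, h, rfl⟩))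
      · exact Or.inr (Or.inl rfl)
      · exact Or.inl (Or.inr ⟨j, h, rfl⟩)
  · exact Or.inr (Or.inr (Or.inr h))

/-- Both sides are spanned by parts of the basis; the sign of the degree keeps the parts disjoint.
-/
theorem isCompl_nPos_bNeg :
    IsCompl (nPos r).toSubmodule (bNeg r).toSubmodule := by
  refine D_linearIndependent.isCompl_span_image span_range_D ?_
  rw [isCompl_iff, Set.disjoint_left, codisjoint_iff]
  constructor
  · intro p hp hp'
    have h1 := deg_of_pos r hp
    rcases hp' with hp' | hp'
    · exact h1.ne (deg_of_cartan r hp')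
    · exact h1.not_gt (deg_of_neg r hp')
  · ext p
    simpa using mem_posIdx_or r p

theorem nNeg_sup_bPos : (nNeg r).toSubmodule ⊔ (bPos r).toSubmodule = ⊤ := by
  change Submodule.span ℂ _ ⊔ Submodule.span ℂ _ = _
  rw [← Submodule.span_union, ← Set.image_union]
  have h : negIdx r ∪ (cartanIdx n ∪ posIdx r) = Set.univ := by
    ext p
    have := mem_posIdx_or r p
    simp only [Set.mem_union, Set.mem_univ, iff_true]
    tauto
  rw [h, Set.image_univ, span_range_D]

/-- The degree of `D_i(m)`, shifted so as to be nonnegative. -/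
def natDeg (p : Idx n) : ℕ := (deg r p + (2 * n + 1)).toNat

theorem lie_D_mem_span_lower (x : nPos r) (p : Idx n) :
    ⁅(x : Witt n), D p⁆ ∈ Submodule.span ℂ (D '' {q | natDeg r q < natDeg r p}) := by
  obtain ⟨x, hx⟩ := x
  have hx' : x ∈ Submodule.span ℂ (D '' posIdx r) := hx
  have hlt : ∀ {q q' : Idx n}, deg r q < deg r q' → natDeg r q < natDeg r q' := by
    intro q q' h
    have := neg_le_deg r q
    unfold natDeg
    omega
  -- A structure constant may vanish, and then the index next to it need not have the additive
  -- degree; only nonzero coefficients need the estimate.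
  have hmem : ∀ {q q' : Idx n} (c : ℕ), (c ≠ 0 → deg r q' < deg r q) →
      (c : ℂ) • D q' ∈ Submodule.span ℂ (D '' {q' | natDeg r q' < natDeg r q}) := by
    intro q q' c hc
    by_cases h : c = 0
    · rw [h, Nat.cast_zero, zero_smul]
      exact Submodule.zero_mem _
    · exact Submodule.smul_mem _ _ (Submodule.subset_span ⟨q', hlt (hc h), rfl⟩)
  refine lie_mem_of_mem_span_left ?_ hx'
  rintro _ ⟨q, hq, rfl⟩
  change ⁅D q, D p⁆ ∈ _
  have hq' := deg_of_pos r hq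
  rw [lie_D]
  refine Submodule.sub_mem _ (hmem _ fun h => ?_) (hmem _ fun h => ?_)
  · rw [deg_add r h]
    omega
  · rw [add_comm q.2, deg_add r h]
    omega

end Degree

/-! ### Weight spaces and their finiteness -/

section Weights

variable {n : ℕ}

theorem mem_wtSpace {V : Type} [AddCommGroup V] [Module ℂ V] [LieRingModule (Witt n) V]
    [LieModule ℂ (Witt n) V] {ν : Module.Dual ℂ (torus n)} {v : V} :
    v ∈ wtSpace V ν ↔ ∀ h : torus n, ⁅(h : Witt n), v⁆ = ν h • v := Iff.rfl

theorem lie_torus (h h' : torus n) : ⁅(h : Witt n), (h' : Witt n)⁆ = 0 := by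
  obtain ⟨h', hh⟩ := h'
  have hh' : h' ∈ Submodule.span ℂ (D '' cartanIdx n) := hh
  rw [← LieSubmodule.mem_bot (R := ℂ) (L := Witt n) (M := Witt n), ← lie_skew]
  refine (⊥ : LieSubmodule ℂ (Witt n) (Witt n)).neg_mem ?_
  refine lie_mem_of_mem_span_left (P := (⊥ : LieSubmodule ℂ (Witt n) (Witt n)).toSubmodule) ?_ hh'
  rintro _ ⟨p, hp, rfl⟩
  rw [← lie_skew]
  refine (⊥ : LieSubmodule ℂ (Witt n) (Witt n)).neg_mem ?_
  have h0 : wt p h = 0 := by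
    obtain ⟨i, m⟩ := p
    obtain rfl : m = e i := hp
    simp [wt, e_apply]
  have h1 : ⁅(h : Witt n), D p⁆ = 0 := by
    rw [lie_torus_D, h0, zero_smul]
  exact h1

theorem torusProj_coe (h : torus n) : torusProj n (h : Witt n) = h := by
  have key : (torusProj n).comp (torus n).toSubmodule.subtype = LinearMap.id := by
    have hle : ∀ x (hx : x ∈ Submodule.span ℂ (D '' cartanIdx n)),
        x ∈ LinearMap.eqLocus ((torus n).toSubmodule.subtype ∘ₗ torusProj n) LinearMap.id := by
      intro x hx
      refine (Submodule.span_le.2 ?_) hx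
      rintro _ ⟨p, hp, rfl⟩
      change ((torusProj n (D p) : torus n) : Witt n) = D p
      rw [← wittBasis_apply, torusProj, Module.Basis.constr_basis, dif_pos hp, wittBasis_apply]
    exact LinearMap.ext fun x => Subtype.ext (hle x.1 x.2)
  exact LinearMap.congr_fun key h

section Independence

variable (V : Type) [AddCommGroup V] [Module ℂ V] [LieRingModule (Witt n) V]
  [LieModule ℂ (Witt n) V]

/-- The torus acts by commuting operators, and weight spaces lie in their simultaneous generalized
eigenspaces, which are independent. -/
theorem iSupIndep_wtSpace : iSupIndep fun ν : Module.Dual ℂ (torus n) => wtSpace V ν := by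
  let f : torus n → Module.End ℂ V := fun h => LieModule.toEnd ℂ (Witt n) V (h : Witt n)
  have hcomm : ∀ h h', Commute (f h) (f h') := by
    intro h h'
    rw [commute_iff_lie_eq, ← LieHom.map_lie, lie_torus, map_zero]
  have h1 := Module.End.independent_iInf_maxGenEigenspace_of_forall_mapsTo f
    fun i j φ => Module.End.mapsTo_maxGenEigenspace_of_comm (hcomm j i) φ
  have h2 := h1.comp (f := fun ν : Module.Dual ℂ (torus n) => (ν : torus n → ℂ))
    DFunLike.coe_injective
  refine h2.mono fun ν v hv => ?_
  rw [Function.comp_apply, Submodule.mem_iInf]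
  intro h
  have h3 : v ∈ (f h).eigenspace (ν h) := by
    rw [Module.End.mem_eigenspace_iff]
    exact hv h
  exact (f h).genEigenspace (ν h) |>.monotone le_top h3

variable {V}

theorem lie_mem_iSup_wtSpace (x : Witt n) {v : V}
    (hv : v ∈ ⨆ ν : Module.Dual ℂ (torus n), wtSpace V ν) :
    ⁅x, v⁆ ∈ ⨆ ν : Module.Dual ℂ (torus n), wtSpace V ν := by
  have hx : x ∈ Submodule.span ℂ (Set.range D) := by rw [span_range_D]; trivial
  refine lie_mem_of_mem_span_left ?_ hx
  rintro _ ⟨p, rfl⟩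
  have hle : (⨆ ν : Module.Dual ℂ (torus n), wtSpace V ν) ≤
        (⨆ ν : Module.Dual ℂ (torus n), wtSpace V ν).comap (LieModule.toEnd ℂ (Witt n) V (D p)) :=
    iSup_le fun ν v hv => Submodule.mem_iSup_of_mem _ (lie_D_mem rfl hv)
  exact hle hv

/-- The weight of a word applied to a vector of weight `ν`. -/
theorem word_mem_wtSpace {ν : Module.Dual ℂ (torus n)} {v : V} (hv : v ∈ wtSpace V ν)
    (l : List (Idx n)) : word D v l ∈ wtSpace V (ν + (l.map wt).sum) := by
  induction l with
  | nil => rwa [List.map_nil, List.sum_nil, add_zero, word_nil]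
  | cons p l ih =>
    rw [word_cons]
    refine lie_D_mem ?_ ih
    rw [List.map_cons, List.sum_cons]
    abel

end Independence

section Induced

variable {S : Set (Idx n)} {hS : IsClosedIdx S} {hd : ∀ p ∈ S, p ∉ cartanIdx n}
  {μ : Module.Dual ℂ (torus n)}

theorem lie_torus_gen (h : torus n) : ⁅(h : Witt n), Ind.gen (extendChar hS hd μ)⁆ =
    μ h • Ind.gen (extendChar hS hd μ) := by
  have hh : (h : Witt n) ∈ spanD (cartanIdx n ∪ S) (closed_union hS) :=
    Submodule.span_mono (Set.image_mono Set.subset_union_left) h.2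
  have h1 := Ind.lie_gen (extendChar hS hd μ) ⟨h, hh⟩
  have h2 : extendChar hS hd μ ⟨h, hh⟩ = μ h := congrArg μ (torusProj_coe h)
  rw [h2] at h1
  exact h1

theorem lie_D_gen {p : Idx n} (hp : p ∈ S) : ⁅D p, Ind.gen (extendChar hS hd μ)⁆ = 0 := by
  have hh : D p ∈ spanD (cartanIdx n ∪ S) (closed_union hS) := D_mem_spanD _ (Or.inr hp)
  have h1 := Ind.lie_gen (extendChar hS hd μ) ⟨D p, hh⟩
  have h2 : extendChar hS hd μ ⟨D p, hh⟩ = μ (torusProj n (D p)) := rfl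
  rw [h2, torusProj_D_of_notMem (hd p hp), map_zero, zero_smul] at h1
  exact h1

theorem gen_mem_wtSpace :
    Ind.gen (extendChar hS hd μ) ∈ wtSpace (Ind _ (CharModule (extendChar hS hd μ))) μ :=
  fun h => lie_torus_gen h

theorem span_word_eq_top {S' : Set (Idx n)} {hS' : IsClosedIdx S'}
    (hsup : (spanD S' hS').toSubmodule ⊔
      (spanD (cartanIdx n ∪ S) (closed_union hS)).toSubmodule = ⊤) :
    Submodule.span ℂ (word D (Ind.gen (extendChar hS hd μ)) '' {l | ∀ p ∈ l, p ∈ S'}) = ⊤ := by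
  refine Ind.eq_top_of_stable _ hsup (Submodule.subset_span ⟨[], by simp, rfl⟩) ?_
  intro x hx m hm
  have hx' : x ∈ Submodule.span ℂ (D '' S') := hx
  refine lie_mem_of_mem_span_left ?_ hx'
  rintro _ ⟨q, hq, rfl⟩
  have hle : Submodule.span ℂ (word D (Ind.gen (extendChar hS hd μ)) '' {l | ∀ p ∈ l, p ∈ S'}) ≤
      (Submodule.span ℂ (word D (Ind.gen (extendChar hS hd μ)) '' {l | ∀ p ∈ l, p ∈ S'})).comap
        (LieModule.toEnd ℂ (Witt n) _ (D q)) := by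
    rw [Submodule.span_le]
    rintro _ ⟨l, hl, rfl⟩
    refine Submodule.subset_span ⟨q :: l, ?_, rfl⟩
    intro p hp
    rcases List.mem_cons.1 hp with rfl | hp
    · exact hq
    · exact hl p hp
  exact hle hm

end Induced

theorem wt_sum_gradingElt (r : Fin n → Fin n → Prop) (l : List (Idx n)) :
    (l.map wt).sum (gradingElt r) = ((l.map (deg r)).sum : ℂ) := by
  induction l with
  | nil => simp
  | cons p l ih =>
    rw [List.map_cons, List.sum_cons, LinearMap.add_apply, ih, wt_gradingElt, List.map_cons,
      List.sum_cons, Int.cast_add]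

variable (r : Fin n → Fin n → Prop) [IsStrictTotalOrder (Fin n) r]
  (μ : Module.Dual ℂ (torus n))

theorem iSup_wtSpace_MNeg : ⨆ ν : Module.Dual ℂ (torus n), wtSpace (MNeg r μ) ν = ⊤ := by
  refine Ind.eq_top_of_gen_mem (Submodule.mem_iSup_of_mem μ gen_mem_wtSpace) ?_
  intro x m hm
  exact lie_mem_iSup_wtSpace x hm

/-- The weight spaces of the lowest weight Verma modules are finite-dimensional. -/
theorem finite_wtSpace_MNeg (ν : Module.Dual ℂ (torus n)) :
    Module.Finite ℂ (wtSpace (MNeg r μ) ν) := by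
  let A : Module.Dual ℂ (torus n) → Set (List (Idx n)) := fun ν =>
    {l | (∀ p ∈ l, p ∈ posIdx r) ∧ μ + (l.map wt).sum = ν}
  let gen := Ind.gen (extendChar (closed_negIdx r) (fun _ => negIdx_disjoint r) μ)
  let W : Module.Dual ℂ (torus n) → Submodule ℂ (MNeg r μ) := fun ν =>
    Submodule.span ℂ (word D gen '' A ν)
  -- Each `W ν` lies in the weight space of `ν` and the `W ν` together span, so independence of the
  -- weight spaces forces equality.
  have hW : W = fun ν => wtSpace (MNeg r μ) ν := by
    refine ((iSupIndep_wtSpace (MNeg r μ)).le_iff_eq_of_iSup_eq_top ?_).1 ?_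
    · rw [eq_top_iff, ← span_word_eq_top (hS := closed_negIdx r)
        (hd := fun _ => negIdx_disjoint r) (μ := μ) (isCompl_nPos_bNeg r).sup_eq_top,
        Submodule.span_le]
      rintro _ ⟨l, hl, rfl⟩
      exact Submodule.mem_iSup_of_mem (μ + (l.map wt).sum)
        (Submodule.subset_span ⟨l, ⟨hl, rfl⟩, rfl⟩)
    · intro ν
      refine Submodule.span_le.2 ?_
      rintro _ ⟨l, ⟨-, rfl⟩, rfl⟩
      exact word_mem_wtSpace gen_mem_wtSpace l
  have hA : (A ν).Finite := by
    by_cases hne : (A ν).Nonempty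
    · obtain ⟨l₀, -, hl₀⟩ := hne
      -- Every letter of `𝔫₊` has degree at most `-1`, and the weight fixes the total degree; hence
      -- the length is bounded, and the alphabet is finite.
      have hlen : ∀ l : List (Idx n), (∀ p ∈ l, p ∈ posIdx r) →
          (l.length : ℤ) ≤ -(l.map (deg r)).sum := by
        intro l hl
        induction l with
        | nil => simp
        | cons p l ih =>
          have h1 := ih fun q hq => hl q (List.mem_cons_of_mem _ hq)
          have h2 := deg_of_pos r (hl p List.mem_cons_self)
          rw [List.length_cons, List.map_cons, List.sum_cons]
          push_cast
          omega
      have hfin : Finite (posIdx r) := finite_posIdx r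
      refine ((List.finite_length_le (posIdx r) (-(l₀.map (deg r)).sum).toNat).image
        (List.map Subtype.val)).subset ?_
      rintro l ⟨hl, hlν⟩
      refine ⟨l.attach.map fun p => ⟨p.1, hl p.1 p.2⟩, ?_, ?_⟩
      · have h1 : (l.map wt).sum (gradingElt r) = (l₀.map wt).sum (gradingElt r) := by
          rw [add_left_cancel (hlν.trans hl₀.symm)]
        rw [wt_sum_gradingElt, wt_sum_gradingElt, Int.cast_inj] at h1
        have h2 := hlen l hl
        rw [h1] at h2
        simp only [Set.mem_ofPred_eq, List.length_map, List.length_attach]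
        omega
      · rw [List.map_map]
        exact List.attach_map_subtype_val l
    · rw [Set.not_nonempty_iff_eq_empty.1 hne]
      exact Set.finite_empty
  have h := congrFun hW ν
  change W ν = wtSpace (MNeg r μ) ν at h
  rw [← h]
  exact Module.Finite.span_of_finite ℂ (hA.image _)

end Weights

/-! ### The completion as a full dual -/

section Completion

variable {n : ℕ} {L M : Type} [AddCommGroup L] [Module ℂ L] [LieRingModule (Witt n) L]
  [LieModule ℂ (Witt n) L] [AddCommGroup M] [Module ℂ M] [LieRingModule (Witt n) M]
  [LieModule ℂ (Witt n) M]

theorem dual_ext_wtSpace (hM : ⨆ ν : Module.Dual ℂ (torus n), wtSpace M ν = ⊤)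
    {F F' : Module.Dual ℂ M}
    (h : ∀ ν : Module.Dual ℂ (torus n), ∀ m ∈ wtSpace M ν, F m = F' m) : F = F' := by
  have hle : (⊤ : Submodule ℂ M) ≤ LinearMap.eqLocus F F' := by
    rw [← hM]
    exact iSup_le h
  ext m
  exact hle (Submodule.mem_top : m ∈ ⊤)

/-- A family of linear forms on the weight spaces glues to a linear form. -/
theorem exists_dual_of_wtSpace (hM : ⨆ ν : Module.Dual ℂ (torus n), wtSpace M ν = ⊤)
    (G : Module.Dual ℂ (torus n) → Module.Dual ℂ M) :
    ∃ F : Module.Dual ℂ M, ∀ ν : Module.Dual ℂ (torus n), ∀ m ∈ wtSpace M ν, F m = G ν m := by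
  classical
  have hint : DirectSum.IsInternal fun ν : Module.Dual ℂ (torus n) => wtSpace M ν :=
    DirectSum.isInternal_submodule_of_iSupIndep_of_iSup_eq_top (iSupIndep_wtSpace _) hM
  let E := LinearEquiv.ofBijective
    (DirectSum.coeLinearMap fun ν : Module.Dual ℂ (torus n) => wtSpace M ν) hint
  refine ⟨DirectSum.toModule ℂ _ ℂ (fun ν => G ν ∘ₗ (wtSpace M ν).subtype) ∘ₗ
    E.symm.toLinearMap, fun ν m hm => ?_⟩
  have h1 : E (DirectSum.lof ℂ _ (fun ν => wtSpace M ν) ν ⟨m, hm⟩) = m :=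
    DirectSum.coeLinearMap_lof _ ν ⟨m, hm⟩
  have h2 : E.symm m = DirectSum.lof ℂ _ (fun ν => wtSpace M ν) ν ⟨m, hm⟩ := by
    rw [LinearEquiv.symm_apply_eq, h1]
  rw [LinearMap.comp_apply, LinearEquiv.coe_coe, h2, DirectSum.toModule_lof]
  rfl

/-- An invariant pairing vanishes on pairs of weight vectors whose weights do not cancel. -/
theorem dual_apply_eq_zero (j : L →ₗ⁅ℂ, Witt n⁆ Module.Dual ℂ M) {κ ν : Module.Dual ℂ (torus n)}
    (h : ν ≠ -κ) {x : L} (hx : x ∈ wtSpace L κ) {m : M} (hm : m ∈ wtSpace M ν) : j x m = 0 := by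
  obtain ⟨t, ht⟩ : ∃ t, ν t ≠ (-κ) t := by
    by_contra! hc
    exact h (LinearMap.ext hc)
  have h1 : j ⁅(t : Witt n), x⁆ m = -j x ⁅(t : Witt n), m⁆ := by
    rw [LieModuleHom.map_lie, Module.Dual.lie_apply]
  rw [mem_wtSpace.1 hx t, mem_wtSpace.1 hm t, map_smul, map_smul, LinearMap.smul_apply,
    smul_eq_mul, smul_eq_mul] at h1
  have h2 : (ν t + κ t) * j x m = 0 := by linear_combination h1
  refine (mul_eq_zero.1 h2).resolve_left fun h3 => ht ?_
  rw [LinearMap.neg_apply]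
  linear_combination h3

/-- If `L` and `M` are weight modules in separating duality, where the weight spaces of `M` are
finite-dimensional, then the completion of `L` is the dual of `M`. -/
theorem exists_completion_hom_dual (hL : ⨆ ν : Module.Dual ℂ (torus n), wtSpace L ν = ⊤)
    (hM : ⨆ ν : Module.Dual ℂ (torus n), wtSpace M ν = ⊤)
    (hfin : ∀ ν : Module.Dual ℂ (torus n), Module.Finite ℂ (wtSpace M ν))
    (j : L →ₗ⁅ℂ, Witt n⁆ Module.Dual ℂ M) (hj : Function.Injective j)
    (hsep : ∀ m, (∀ x, j x m = 0) → m = 0) :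
    ∃ E : Completion n L →ₗ⁅ℂ, Witt n⁆ Module.Dual ℂ M, Function.Bijective E := by
  -- Weights must cancel in an invariant pairing, so on the weight space of `ν` only the component
  -- of weight `-ν` contributes.
  choose E hE using fun f : Completion n L =>
    exists_dual_of_wtSpace hM fun ν => j (f.comp (-ν))
  have hadd : ∀ f f', E (f + f') = E f + E f' := by
    intro f f'
    refine dual_ext_wtSpace hM fun ν m hm => ?_
    rw [LinearMap.add_apply, hE _ ν m hm, hE _ ν m hm, hE _ ν m hm, ← LinearMap.add_apply,
      ← map_add]
    rfl
  have hsmul : ∀ (c : ℂ) f, E (c • f) = c • E f := by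
    intro c f
    refine dual_ext_wtSpace hM fun ν m hm => ?_
    rw [LinearMap.smul_apply, hE _ ν m hm, hE _ ν m hm, ← LinearMap.smul_apply, ← map_smul]
    rfl
  have hlie : ∀ (x : Witt n) f, E ⁅x, f⁆ = ⁅x, E f⁆ := by
    intro x f
    let E' : Completion n L →ₗ[ℂ] Module.Dual ℂ M :=
      { toFun := E, map_add' := hadd, map_smul' := hsmul }
    let P : Submodule ℂ (Witt n) := LinearMap.eqLocus
      (E' ∘ₗ LinearMap.applyₗ f ∘ₗ (LieModule.toEnd ℂ (Witt n) (Completion n L)).toLinearMap)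
      (LinearMap.applyₗ (E f) ∘ₗ (LieModule.toEnd ℂ (Witt n) (Module.Dual ℂ M)).toLinearMap)
    have hP : (⊤ : Submodule ℂ (Witt n)) ≤ P := by
      rw [← span_range_D, Submodule.span_le]
      rintro _ ⟨p, rfl⟩
      change E ⁅D p, f⁆ = ⁅D p, E f⁆
      refine dual_ext_wtSpace hM fun ν m hm => ?_
      have h1 : (⁅D p, f⁆ : Completion n L).comp (-ν) = ⁅D p, f.comp (-ν - wt p)⁆ := by
        rw [Completion.lie_def, Completion.act_D, Completion.comp_actD]
      rw [hE _ ν m hm, h1, LieModuleHom.map_lie, Module.Dual.lie_apply, Module.Dual.lie_apply,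
        hE f (ν + wt p) _ (lie_D_mem rfl hm), neg_add']
    exact hP (Submodule.mem_top : x ∈ ⊤)
  refine ⟨{ toFun := E, map_add' := hadd, map_smul' := hsmul, map_lie' := fun {x f} => hlie x f },
    ?_, ?_⟩
  · refine (injective_iff_map_eq_zero _).2 fun f hf => ?_
    have hf' : E f = 0 := hf
    refine Completion.ext_comp fun κ => hj ?_
    refine Eq.trans ?_ (map_zero j).symm
    refine dual_ext_wtSpace hM fun ν m hm => ?_
    by_cases hν : ν = -κ
    · have h1 := hE f ν m hm
      rw [hf', hν, neg_neg] at h1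
      exact h1.symm
    · exact dual_apply_eq_zero j hν (f κ).2 hm
  · intro G
    have hκ : ∀ κ : Module.Dual ℂ (torus n), ∃ x ∈ wtSpace L κ, ∀ m ∈ wtSpace M (-κ),
        j x m = G m := by
      intro κ
      let ρ : wtSpace L κ →ₗ[ℂ] Module.Dual ℂ (wtSpace M (-κ)) :=
        (wtSpace M (-κ)).subtype.dualMap ∘ₗ (j : L →ₗ[ℂ] Module.Dual ℂ M) ∘ₗ (wtSpace L κ).subtype
      have hρ : ∀ x m, ρ x m = j x m := fun x m => rfl
      have hfin' := hfin (-κ)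
      -- The forms coming from weight `κ` have no common zero in the space of weight `-κ`, since the
      -- other weights of `L` pair to zero with it. In finite dimension such forms span the dual.
      have htop : Submodule.span ℂ (Set.range ρ) = ⊤ := by
        refine Submodule.span_eq_top_of_ne_zero fun z hz => ?_
        by_contra! hc
        refine hz (Subtype.ext (hsep _ fun x => ?_))
        have hle : (⊤ : Submodule ℂ L) ≤ LinearMap.ker
            (LinearMap.applyₗ (z : M) ∘ₗ (j : L →ₗ[ℂ] Module.Dual ℂ M)) := by
          rw [← hL]
          refine iSup_le fun ν x hx => ?_
          by_cases hν : κ = ν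
          · subst hν
            exact hc _ ⟨⟨x, hx⟩, rfl⟩
          · exact dual_apply_eq_zero j (fun h => hν (neg_injective h)) hx z.2
        exact hle (Submodule.mem_top : x ∈ ⊤)
      have hr : LinearMap.range ρ = ⊤ := by
        rw [← htop, ← LinearMap.coe_range, Submodule.span_eq]
      obtain ⟨x, hx⟩ := LinearMap.range_eq_top.1 hr (G ∘ₗ (wtSpace M (-κ)).subtype)
      refine ⟨x, x.2, fun m hm => ?_⟩
      exact LinearMap.congr_fun hx ⟨m, hm⟩
    choose x hx hxG using hκ
    let f : Completion n L := fun κ => ⟨x κ, hx κ⟩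
    refine ⟨f, ?_⟩
    change E f = G
    refine dual_ext_wtSpace hM fun ν m hm => ?_
    rw [hE f ν m hm]
    exact hxG (-ν) m (by rwa [neg_neg])

end Completion

/-! ### The highest weight line and the contravariant pairing -/

theorem lie_lie_eq_zero_of_eq_smul {g V : Type} [LieRing g] [LieAlgebra ℂ g] [AddCommGroup V]
    [Module ℂ V] [LieRingModule g V] [LieModule ℂ g V] {x y : g} {t : ℂ} {v : V}
    (h : ⁅x, y⁆ = t • y) (hy : ⁅y, v⁆ = 0) : ⁅y, ⁅x, v⁆⁆ = 0 := by
  have h1 := leibniz_lie x y v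
  rw [h, smul_lie, hy, smul_zero, zero_add, lie_zero] at h1
  exact h1.symm

/-- If a vector space is spanned by an eigenvector `v₀` for the eigenvalue `t` of an endomorphism
`H` and by eigenvectors for other eigenvalues, then each vector is mapped by a polynomial in `H` to
a nonzero multiple of its component along `v₀`. -/
theorem exists_polynomial_aeval_eq_smul {V : Type} [AddCommGroup V] [Module ℂ V]
    {H : Module.End ℂ V} {v₀ : V} {t : ℂ} (ε : Module.Dual ℂ V) (hv₀ : H v₀ = t • v₀) {T : Set V}
    (hT : Submodule.span ℂ T = ⊤)
    (h : ∀ v ∈ T, (v = v₀ ∧ ε v₀ = 1) ∨ ∃ s, s ≠ t ∧ H v = s • v ∧ ε v = 0) (m : V) :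
    ∃ (q : Polynomial ℂ) (c : ℂ), c ≠ 0 ∧ Polynomial.aeval H q m = (c * ε m) • v₀ := by
  have hgen : ∀ q : Polynomial ℂ, Polynomial.aeval H q v₀ = q.eval t • v₀ := fun q =>
    Module.End.aeval_apply_of_mem_apply_eq_smul hv₀
  -- Taking `c = q(t)` makes the scalar multiplicative in `q`, so that a sum of two vectors is
  -- handled by the product of their polynomials.
  suffices hq : ∃ q : Polynomial ℂ, q.eval t ≠ 0 ∧
      Polynomial.aeval H q m = (q.eval t * ε m) • v₀ by
    obtain ⟨q, hq, hm⟩ := hq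
    exact ⟨q, _, hq, hm⟩
  have hm : m ∈ Submodule.span ℂ T := by rw [hT]; trivial
  induction hm using Submodule.span_induction with
  | mem v hv =>
    rcases h v hv with ⟨rfl, h1⟩ | ⟨s, hs, h1, h2⟩
    · exact ⟨1, by simp, by simp [h1]⟩
    -- `X - s` kills the eigenvector for `s` and does not vanish at `t`.
    · refine ⟨Polynomial.X - Polynomial.C s, by simpa [sub_eq_zero] using hs.symm, ?_⟩
      rw [Module.End.aeval_apply_of_mem_apply_eq_smul h1, h2]
      simp
  | zero => exact ⟨1, by simp, by simp⟩
  | add m m' _ _ hm hm' =>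
    obtain ⟨q, hq, h⟩ := hm
    obtain ⟨q', hq', h'⟩ := hm'
    refine ⟨q * q', by rw [Polynomial.eval_mul]; exact mul_ne_zero hq hq', ?_⟩
    have h1 : Polynomial.aeval H (q * q') m' = (q.eval t * q'.eval t * ε m') • v₀ := by
      rw [map_mul, Module.End.mul_apply, h', map_smul, hgen, smul_smul]
      congr 1
      ring
    have h2 : Polynomial.aeval H (q * q') m = (q.eval t * q'.eval t * ε m) • v₀ := by
      rw [mul_comm q, map_mul, Module.End.mul_apply, h, map_smul, hgen, smul_smul]
      congr 1
      ring
    rw [map_add, h1, h2, ← add_smul, Polynomial.eval_mul, map_add, mul_add]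
  | smul c m _ hm =>
    obtain ⟨q, hq, h⟩ := hm
    refine ⟨q, hq, ?_⟩
    rw [map_smul, h, map_smul, smul_smul, smul_eq_mul]
    congr 1
    ring

theorem aeval_toEnd_mem {g V : Type} [LieRing g] [LieAlgebra ℂ g] [AddCommGroup V] [Module ℂ V]
    [LieRingModule g V] [LieModule ℂ g V] (N : LieSubmodule ℂ g V) (x : g) (q : Polynomial ℂ)
    {v : V} (hv : v ∈ N) : Polynomial.aeval (LieModule.toEnd ℂ g V x) q v ∈ N := by
  induction q using Polynomial.induction_on' with
  | add p q hp hq => rw [map_add, LinearMap.add_apply]; exact N.add_mem hp hq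
  | monomial k c =>
    rw [Polynomial.aeval_monomial, Module.End.mul_apply, Module.algebraMap_end_apply]
    refine N.smul_mem _ ?_
    induction k with
    | zero => simpa using hv
    | succ k ih =>
      rw [pow_succ', Module.End.mul_apply]
      exact N.lie_mem ih

section HighestWeight

variable {n : ℕ} (r : Fin n → Fin n → Prop) [IsStrictTotalOrder (Fin n) r]
  (μ : Module.Dual ℂ (torus n))

theorem sum_deg_pos {p : Idx n} {l : List (Idx n)} (hl : ∀ q ∈ p :: l, q ∈ negIdx r) :
    0 < ((p :: l).map (deg r)).sum := by
  have h1 : 0 ≤ (l.map (deg r)).sum := by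
    refine List.sum_nonneg fun k hk => ?_
    obtain ⟨q, hq, rfl⟩ := List.mem_map.1 hk
    exact (deg_of_neg r (hl q (List.mem_cons_of_mem _ hq))).le
  have h2 := deg_of_neg r (hl p List.mem_cons_self)
  rw [List.map_cons, List.sum_cons]
  omega

/-- The canonical generator of the highest weight Verma module. -/
abbrev genPos : MPos r μ := Ind.gen (extendChar (closed_posIdx r) (fun _ => posIdx_disjoint r) μ)

/-- The canonical generator of the lowest weight Verma module. -/
abbrev genNeg : MNeg r μ := Ind.gen (extendChar (closed_negIdx r) (fun _ => negIdx_disjoint r) μ)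

/-- The contravariant pairing between the Verma modules of highest weight `μ` and lowest weight
`-μ`. -/
theorem exists_pairing : ∃ Φ : MPos r μ →ₗ⁅ℂ, Witt n⁆ Module.Dual ℂ (MNeg r (-μ)),
    Φ (genPos r μ) (genNeg r (-μ)) = 1 := by
  obtain ⟨F, hF, hF1, huniq⟩ := exists_whittaker_dual (isCompl_nPos_bNeg r)
    (extendChar (closed_negIdx r) (fun _ => negIdx_disjoint r) (-μ)) 0
  have hF' : ∀ x : nPos r, ⁅(x : Witt n), F⁆ = 0 := by
    intro x
    rw [mem_whittaker.1 hF x, LieHom.zero_apply, zero_smul]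
  -- The torus normalizes `𝔫₊`, so `hF` is again `𝔫₊`-invariant, hence a multiple of `F`; the value
  -- on the generator gives the factor.
  have htor : ∀ h : torus n, ⁅(h : Witt n), F⁆ = μ h • F := by
    intro h
    have hgen : ⁅(h : Witt n), F⁆ (genNeg r (-μ)) = μ h := by
      rw [Module.Dual.lie_apply, lie_torus_gen, map_smul, hF1, LinearMap.neg_apply, smul_eq_mul,
        mul_one, neg_neg]
    have hW : ⁅(h : Witt n), F⁆ ∈ whittaker (0 : LieAlgebra.LieCharacter ℂ (nPos r))
        (Module.Dual ℂ (MNeg r (-μ))) := by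
      rw [mem_whittaker]
      intro x
      have hx : (x : Witt n) ∈ Submodule.span ℂ (D '' posIdx r) := x.2
      rw [LieHom.zero_apply, zero_smul, ← LieSubmodule.mem_bot (R := ℂ) (L := Witt n)]
      refine lie_mem_of_mem_span_left
        (P := (⊥ : LieSubmodule ℂ (Witt n) (Module.Dual ℂ (MNeg r (-μ)))).toSubmodule) ?_ hx
      rintro _ ⟨p, hp, rfl⟩
      have h0 : ⁅D p, F⁆ = 0 := hF' ⟨D p, D_mem_spanD _ hp⟩
      exact lie_lie_eq_zero_of_eq_smul (lie_torus_D h p) h0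
    rw [huniq _ hW, hgen]
  have hb : ∀ x : bPos r, ⁅(x : Witt n), F⁆ =
      extendChar (closed_posIdx r) (fun _ => posIdx_disjoint r) μ x • F := by
    intro x
    have hle : Submodule.span ℂ (D '' (cartanIdx n ∪ posIdx r)) ≤ LinearMap.eqLocus
        (LinearMap.applyₗ F ∘ₗ
          (LieModule.toEnd ℂ (Witt n) (Module.Dual ℂ (MNeg r (-μ)))).toLinearMap)
        (LinearMap.toSpanSingleton ℂ _ F ∘ₗ μ ∘ₗ torusProj n) := by
      rw [Submodule.span_le]
      rintro _ ⟨p, hp, rfl⟩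
      change ⁅D p, F⁆ = μ (torusProj n (D p)) • F
      rcases hp with hp | hp
      · have h1 : torusProj n (D p) = ⟨D p, D_mem_spanD _ hp⟩ := torusProj_coe ⟨D p, _⟩
        rw [h1]
        exact htor ⟨D p, D_mem_spanD _ hp⟩
      · rw [torusProj_D_of_notMem (posIdx_disjoint r hp), map_zero, zero_smul]
        exact hF' ⟨D p, D_mem_spanD _ hp⟩
    exact hle x.2
  obtain ⟨Φ, hΦ⟩ := Ind.exists_lift _ hb
  exact ⟨Φ, by rw [hΦ]; exact hF1⟩

variable {r μ}

/-- For each vector of the Verma module of highest weight `μ` there is a polynomial in the grading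
element that projects it to the highest weight space. -/
theorem exists_polynomial_smul_genPos
    {Φ : MPos r μ →ₗ⁅ℂ, Witt n⁆ Module.Dual ℂ (MNeg r (-μ))}
    (hΦ : Φ (genPos r μ) (genNeg r (-μ)) = 1) (m : MPos r μ) :
    ∃ (q : Polynomial ℂ) (c : ℂ), c ≠ 0 ∧
      Polynomial.aeval (LieModule.toEnd ℂ (Witt n) (MPos r μ) (gradingElt r : Witt n)) q m =
        (c * Φ m (genNeg r (-μ))) • genPos r μ := by
  have hspan := span_word_eq_top (hS := closed_posIdx r) (hd := fun _ => posIdx_disjoint r)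
    (μ := μ) (nNeg_sup_bPos r)
  refine exists_polynomial_aeval_eq_smul (t := μ (gradingElt r))
    (LinearMap.applyₗ (genNeg r (-μ)) ∘ₗ (Φ : MPos r μ →ₗ[ℂ] Module.Dual ℂ (MNeg r (-μ))))
    (lie_torus_gen (gradingElt r)) hspan ?_ m
  rintro _ ⟨l, hl, rfl⟩
  have hl' : ∀ p ∈ l, p ∈ negIdx r := hl
  clear hl
  cases l with
  | nil => exact Or.inl ⟨rfl, hΦ⟩
  | cons p l =>
    refine Or.inr ⟨μ (gradingElt r) + ((((p :: l).map (deg r)).sum : ℤ) : ℂ), ?_, ?_, ?_⟩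
    · rw [ne_eq, add_eq_left, Int.cast_eq_zero]
      exact (sum_deg_pos r hl').ne'
    · have h1 := word_mem_wtSpace (gen_mem_wtSpace (hS := closed_posIdx r)
        (hd := fun _ => posIdx_disjoint r) (μ := μ)) (p :: l) (gradingElt r)
      rw [LinearMap.add_apply, wt_sum_gradingElt] at h1
      exact h1
    -- The leftmost letter lies in `𝔫₋`; moved across the pairing, it kills the lowest weight
    -- generator.
    · change Φ ⁅D p, word D (genPos r μ) l⁆ (genNeg r (-μ)) = 0
      rw [LieModuleHom.map_lie, Module.Dual.lie_apply, lie_D_gen (hl' p List.mem_cons_self),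
        map_zero, neg_zero]

/-- The sum of the proper submodules of the Verma module is the kernel of the pairing. -/
theorem ker_pairing {Φ : MPos r μ →ₗ⁅ℂ, Witt n⁆ Module.Dual ℂ (MNeg r (-μ))}
    (hΦ : Φ (genPos r μ) (genNeg r (-μ)) = 1) :
    sSup {N : LieSubmodule ℂ (Witt n) (MPos r μ) | N ≠ ⊤} = Φ.ker := by
  apply le_antisymm
  · refine sSup_le fun N hN m hm => ?_
    rw [LieModuleHom.mem_ker]
    by_contra hne
    -- The common zeros of `Φ(N)` form a submodule; if it contained the generator, `Φ` would vanish
    -- on `N`.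
    have h1 : ∃ m ∈ N, Φ m (genNeg r (-μ)) ≠ 0 := by
      by_contra! hc
      let K : Submodule ℂ (MNeg r (-μ)) :=
        { carrier := {x | ∀ m ∈ N, Φ m x = 0}
          add_mem' := fun {x y} hx hy m hm => by rw [map_add, hx m hm, hy m hm, add_zero]
          zero_mem' := fun m _ => map_zero _
          smul_mem' := fun c x hx m hm => by rw [map_smul, hx m hm, smul_zero] }
      have hK : K = ⊤ := by
        refine Ind.eq_top_of_gen_mem hc fun y x hx m hm => ?_
        have h := hx ⁅y, m⁆ (N.lie_mem hm)
        rwa [LieModuleHom.map_lie, Module.Dual.lie_apply, neg_eq_zero] at h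
      refine hne (LinearMap.ext fun x => ?_)
      have hx : x ∈ K := by rw [hK]; trivial
      exact hx m hm
    obtain ⟨m, hm, hm0⟩ := h1
    -- The submodule `N` is stable under polynomials in the grading element, so it contains a
    -- nonzero multiple of the highest weight generator.
    obtain ⟨q, c, hc, h2⟩ := exists_polynomial_smul_genPos hΦ m
    have h3 := aeval_toEnd_mem N (gradingElt r : Witt n) q hm
    rw [h2] at h3
    have h4 := N.smul_mem (c * Φ m (genNeg r (-μ)))⁻¹ h3
    rw [inv_smul_smul₀ (mul_ne_zero hc hm0)] at h4
    have h5 : N.toSubmodule = ⊤ := Ind.eq_top_of_gen_mem h4 fun x m hm => N.lie_mem hm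
    exact hN (by rwa [LieSubmodule.toSubmodule_eq_top] at h5)
  · refine le_sSup fun h => ?_
    have h1 : genPos r μ ∈ Φ.ker := by rw [h]; trivial
    rw [LieModuleHom.mem_ker] at h1
    rw [h1] at hΦ
    exact zero_ne_one hΦ

variable (r μ)

/-- The simple highest weight module embeds into the dual of the lowest weight Verma module. -/
theorem exists_LPos_hom_dual : ∃ j : LPos r μ →ₗ⁅ℂ, Witt n⁆ Module.Dual ℂ (MNeg r (-μ)),
    Function.Injective j ∧ j ≠ 0 := by
  obtain ⟨Φ, hΦ⟩ := exists_pairing r μ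
  have hker := ker_pairing hΦ
  set K := sSup {N : LieSubmodule ℂ (Witt n) (MPos r μ) | N ≠ ⊤} with hKdef
  have hK : ∀ m, m ∈ K ↔ Φ m = 0 := fun m => by rw [hker, LieModuleHom.mem_ker]
  let j₀ : (MPos r μ ⧸ K) →ₗ[ℂ] Module.Dual ℂ (MNeg r (-μ)) :=
    K.toSubmodule.liftQ (Φ : MPos r μ →ₗ[ℂ] Module.Dual ℂ (MNeg r (-μ))) fun m hm => (hK m).1 hm
  have hj₀ : ∀ m, j₀ (LieSubmodule.Quotient.mk m) = Φ m := fun m => rfl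
  let j : (MPos r μ ⧸ K) →ₗ⁅ℂ, Witt n⁆ Module.Dual ℂ (MNeg r (-μ)) :=
    { j₀ with
      map_lie' := fun {x m} => by
        obtain ⟨m, rfl⟩ := LieSubmodule.Quotient.surjective_mk' K m
        change j₀ (LieSubmodule.Quotient.mk ⁅x, m⁆) = ⁅x, j₀ (LieSubmodule.Quotient.mk m)⁆
        rw [hj₀, hj₀, LieModuleHom.map_lie] }
  refine ⟨j, (injective_iff_map_eq_zero j).2 fun m hm => ?_, fun h => ?_⟩
  · obtain ⟨m, rfl⟩ := LieSubmodule.Quotient.surjective_mk' K m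
    have h1 : Φ m = 0 := hm
    exact (LieSubmodule.Quotient.mk_eq_zero K).2 ((hK m).2 h1)
  · have h1 : j (LieSubmodule.Quotient.mk (genPos r μ)) = 0 := by rw [h]; rfl
    have h2 : Φ (genPos r μ) = 0 := h1
    rw [h2] at hΦ
    exact zero_ne_one hΦ

theorem iSup_wtSpace_LPos : ⨆ ν : Module.Dual ℂ (torus n), wtSpace (LPos r μ) ν = ⊤ := by
  set K := sSup {N : LieSubmodule ℂ (Witt n) (MPos r μ) | N ≠ ⊤}
  let π := LieSubmodule.Quotient.mk' K
  have h : (⨆ ν : Module.Dual ℂ (torus n), wtSpace (MPos r μ ⧸ K) ν).comap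
      (π : MPos r μ →ₗ[ℂ] MPos r μ ⧸ K) = ⊤ := by
    refine Ind.eq_top_of_gen_mem ?_ fun x m hm => ?_
    · refine Submodule.mem_iSup_of_mem μ fun h => ?_
      change ⁅(h : Witt n), π (genPos r μ)⁆ = μ h • π (genPos r μ)
      rw [← LieModuleHom.map_lie, lie_torus_gen, map_smul]
    · change π ⁅x, m⁆ ∈ (⨆ ν : Module.Dual ℂ (torus n), wtSpace (MPos r μ ⧸ K) ν)
      rw [LieModuleHom.map_lie]
      exact lie_mem_iSup_wtSpace x hm
  rw [eq_top_iff]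
  rintro m -
  obtain ⟨m, rfl⟩ := LieSubmodule.Quotient.surjective_mk' K m
  have : m ∈ (⨆ ν : Module.Dual ℂ (torus n), wtSpace (MPos r μ ⧸ K) ν).comap
      (π : MPos r μ →ₗ[ℂ] MPos r μ ⧸ K) := by rw [h]; trivial
  exact this

end HighestWeight

/-! ### Simplicity and annihilators of the images -/

section Main

theorem isIrreducible_of_finrank_eq_one {g V : Type} [LieRing g] [LieAlgebra ℂ g] [AddCommGroup V]
    [Module ℂ V] [LieRingModule g V] [LieModule ℂ g V] (h : Module.finrank ℂ V = 1) :
    LieModule.IsIrreducible ℂ g V := by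
  have : Nontrivial V := Module.nontrivial_of_finrank_eq_succ h
  refine LieModule.IsIrreducible.mk fun N hN => ?_
  obtain ⟨v, hv, hv0⟩ := N.toSubmodule.exists_mem_ne_zero_of_ne_bot (by simpa using hN)
  rw [eq_top_iff]
  rintro w -
  obtain ⟨c, rfl⟩ := (finrank_eq_one_iff_of_nonzero' v hv0).1 h w
  exact N.smul_mem c hv

variable {g : Type} [LieRing g] [LieAlgebra ℂ g] {a : LieSubalgebra ℂ g}
  {χ : LieAlgebra.LieCharacter ℂ a}
  {C : Type} [AddCommGroup C] [Module ℂ C] [LieRingModule g C] [LieModule ℂ g C]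

theorem finrank_whittaker_eq_one {w : C} (hw : w ∈ whittaker χ C) (hw0 : w ≠ 0)
    (huniq : ∀ v ∈ whittaker χ C, ∃ c : ℂ, v = c • w) :
    Module.finrank ℂ (whittaker χ C) = 1 := by
  refine (finrank_eq_one_iff_of_nonzero' (⟨w, hw⟩ : whittaker χ C) fun h =>
    hw0 (congrArg Subtype.val h)).2 ?_
  rintro ⟨v, hv⟩
  obtain ⟨c, rfl⟩ := huniq v hv
  exact ⟨c, rfl⟩

theorem gen_mem_whittaker (φ : Ind a (CharModule χ) →ₗ⁅ℂ, g⁆ C) :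
    φ (Ind.gen χ) ∈ whittaker χ C := by
  rw [mem_whittaker]
  intro x
  rw [← LieModuleHom.map_lie, Ind.lie_gen, map_smul]

/-- Frobenius reciprocity: a homomorphism is determined by the image of the generator, which can be
any Whittaker vector. -/
theorem finrank_hom_eq_one {w : C} (hw : w ∈ whittaker χ C) (hw0 : w ≠ 0)
    (huniq : ∀ v ∈ whittaker χ C, ∃ c : ℂ, v = c • w) :
    Module.finrank ℂ (Ind a (CharModule χ) →ₗ⁅ℂ, g⁆ C) = 1 := by
  obtain ⟨φ, hφ⟩ := Ind.exists_lift χ (mem_whittaker.1 hw)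
  refine (finrank_eq_one_iff_of_nonzero' φ ?_).2 fun φ' => ?_
  · rintro rfl
    exact hw0 hφ.symm
  · obtain ⟨c, hc⟩ := huniq _ (gen_mem_whittaker φ')
    refine ⟨c, Ind.hom_ext ?_⟩
    rw [LieModuleHom.smul_apply, hφ, hc]

theorem gen_ne_zero {C : Type} [AddCommGroup C] [Module ℂ C] [LieRingModule g C]
    {φ : Ind a (CharModule χ) →ₗ⁅ℂ, g⁆ C} (hφ : φ ≠ 0) : φ (Ind.gen χ) ≠ 0 :=
  fun h => hφ (Ind.hom_ext h)

theorem eq_top_of_gen_mem_range {C : Type} [AddCommGroup C] [Module ℂ C] [LieRingModule g C]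
    (φ : Ind a (CharModule χ) →ₗ⁅ℂ, g⁆ C)
    (N : LieSubmodule ℂ g φ.range)
    (hN : (⟨φ (Ind.gen χ), (φ.mem_range _).2 ⟨_, rfl⟩⟩ : φ.range) ∈ N) : N = ⊤ := by
  have h : N.toSubmodule.comap (φ : Ind a (CharModule χ) →ₗ[ℂ] C).rangeRestrict = ⊤ := by
    refine Ind.eq_top_of_gen_mem hN fun x m hm => ?_
    have h1 := N.lie_mem (x := x) hm
    have h2 : (φ : Ind a (CharModule χ) →ₗ[ℂ] C).rangeRestrict ⁅x, m⁆ =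
        ⁅x, (⟨φ m, (φ.mem_range _).2 ⟨m, rfl⟩⟩ : φ.range)⁆ :=
      Subtype.ext (LieModuleHom.map_lie φ x m)
    change (φ : Ind a (CharModule χ) →ₗ[ℂ] C).rangeRestrict ⁅x, m⁆ ∈ N
    rw [h2]
    exact h1
  rw [eq_top_iff]
  rintro ⟨_, m, rfl⟩ -
  have hm : m ∈ N.toSubmodule.comap (φ : Ind a (CharModule χ) →ₗ[ℂ] C).rangeRestrict := by
    rw [h]; trivial
  exact hm

/-- The main theorem for a Lie algebra `g = a ⊕ b`, a module `C` that is isomorphic to the dual of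
a simple module induced from a character of `b`, and a submodule `L` of this dual. -/
theorem whittaker_of_completion {ι : Type} {D : ι → g}
    (hD : Submodule.span ℂ (Set.range D) = ⊤)
    {d : ι → ℕ} (hd : ∀ (x : a) p, ⁅(x : g), D p⁆ ∈ Submodule.span ℂ (D '' {q | d q < d p}))
    {b : LieSubalgebra ℂ g} (hab : IsCompl a.toSubmodule b.toSubmodule)
    (β : LieAlgebra.LieCharacter ℂ b)
    [LieModule.IsIrreducible ℂ g (Ind b (CharModule β))]
    {L : Type} [AddCommGroup L] [Module ℂ L] [LieRingModule g L] [LieModule ℂ g L]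
    (j : L →ₗ⁅ℂ, g⁆ Module.Dual ℂ (Ind b (CharModule β))) (hj : Function.Injective j)
    (hj0 : j ≠ 0) (E : C →ₗ⁅ℂ, g⁆ Module.Dual ℂ (Ind b (CharModule β)))
    (hE : Function.Bijective E) (χ : LieAlgebra.LieCharacter ℂ a) :
    (Module.finrank ℂ (whittaker χ C) = 1 ∧ LieModule.IsIrreducible ℂ a (whittaker χ C)) ∧
    Module.finrank ℂ (Ind a (CharModule χ) →ₗ⁅ℂ, g⁆ C) = 1 ∧
    ∀ φ : Ind a (CharModule χ) →ₗ⁅ℂ, g⁆ C, φ ≠ 0 →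
      LieModule.IsIrreducible ℂ g φ.range ∧
      Module.finrank ℂ (whittaker χ φ.range) = 1 ∧
      annihilator g φ.range = annihilator g L := by
  obtain ⟨F, hF, hF1, hFuniq⟩ := exists_whittaker_dual hab β χ
  obtain ⟨w, hwF⟩ := hE.2 F
  have hw : w ∈ whittaker χ C := by
    rw [mem_whittaker]
    intro x
    apply hE.1
    rw [LieModuleHom.map_lie, map_smul, hwF]
    exact hF x
  have hw0 : w ≠ 0 := by
    rintro rfl
    rw [← hwF, map_zero] at hF1
    exact zero_ne_one hF1
  have huniq : ∀ v ∈ whittaker χ C, ∃ c : ℂ, v = c • w := by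
    intro v hv
    -- A Whittaker form is the multiple of `F` given by its value on the generator.
    refine ⟨E v (Ind.gen β), hE.1 ?_⟩
    rw [map_smul, hwF]
    refine hFuniq (E v) ?_
    rw [mem_whittaker]
    intro x
    rw [← LieModuleHom.map_lie, mem_whittaker.1 hv x, map_smul]
  have h1 := finrank_whittaker_eq_one hw hw0 huniq
  refine ⟨⟨h1, isIrreducible_of_finrank_eq_one h1⟩, finrank_hom_eq_one hw hw0 huniq,
    fun φ hφ => ?_⟩
  let v : φ.range := ⟨φ (Ind.gen χ), (φ.mem_range _).2 ⟨_, rfl⟩⟩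
  have hv : v ∈ whittaker χ φ.range := fun x => Subtype.ext (gen_mem_whittaker φ x)
  have hv0 : v ≠ 0 := fun h => gen_ne_zero hφ (congrArg Subtype.val h)
  -- Whittaker vectors of the image are Whittaker vectors of `C`, which form a line already
  -- containing `v`.
  have hvuniq : ∀ v' ∈ whittaker χ φ.range, ∃ c : ℂ, v' = c • v := by
    intro v' hv'
    obtain ⟨c, hc⟩ := huniq _ (gen_mem_whittaker φ)
    obtain ⟨c', hc'⟩ := huniq v' fun x => congrArg Subtype.val (hv' x)
    have hc0 : c ≠ 0 := by
      rintro rfl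
      exact gen_ne_zero hφ (hc.trans (zero_smul _ _))
    refine ⟨c' * c⁻¹, Subtype.ext ?_⟩
    change (v' : C) = (c' * c⁻¹) • φ (Ind.gen χ)
    rw [hc, hc', smul_smul, inv_mul_cancel_right₀ hc0]
  let f : φ.range →ₗ⁅ℂ, g⁆ Module.Dual ℂ (Ind b (CharModule β)) := E.comp φ.range.incl
  have hf : Function.Injective f := hE.1.comp Subtype.val_injective
  have hf0 : f ≠ 0 := fun h => hv0 (hf (by rw [h]; rfl))
  refine ⟨isIrreducible_of_whittaker hD hd hv hv0
    (eq_top_of_gen_mem_range φ) hvuniq, finrank_whittaker_eq_one hv hv0 hvuniq, ?_⟩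
  exact annihilator_eq_of_dual f hf
    (fun m hm => eq_zero_of_forall_dual_apply_eq_zero f hf0 hm) j hj
    (fun m hm => eq_zero_of_forall_dual_apply_eq_zero j hj0 hm)

end Main

end WittWhittaker

end

open WittWhittaker in
theorem theorem91 (n : ℕ) (r : Fin n → Fin n → Prop) [IsStrictTotalOrder (Fin n) r]
    (μ : Module.Dual ℂ (WittWhittaker.torus n))
    (hμ : LieModule.IsIrreducible ℂ (WittWhittaker.Witt n) (WittWhittaker.MNeg r (-μ)))
    (lam : LieAlgebra.LieCharacter ℂ (WittWhittaker.nPos r)) :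
    -- the space of Whittaker vectors in the completion of `L⁺(μ)`
    (Module.finrank ℂ
        (WittWhittaker.whittaker lam (WittWhittaker.Completion n (WittWhittaker.LPos r μ))) = 1 ∧
      LieModule.IsIrreducible ℂ (WittWhittaker.nPos r)
        (WittWhittaker.whittaker lam (WittWhittaker.Completion n (WittWhittaker.LPos r μ)))) ∧
    -- the homomorphism that defines `L(λ, μ)` exists and is unique up to a scalar
    Module.finrank ℂ
      (WittWhittaker.MStd r lam →ₗ⁅ℂ, WittWhittaker.Witt n⁆
        WittWhittaker.Completion n (WittWhittaker.LPos r μ)) = 1 ∧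
    -- the properties of its image `L(λ, μ)`
    ∀ φ : WittWhittaker.MStd r lam →ₗ⁅ℂ, WittWhittaker.Witt n⁆
        WittWhittaker.Completion n (WittWhittaker.LPos r μ), φ ≠ 0 →
      LieModule.IsIrreducible ℂ (WittWhittaker.Witt n) φ.range ∧
      Module.finrank ℂ (WittWhittaker.whittaker lam φ.range) = 1 ∧
      WittWhittaker.annihilator (WittWhittaker.Witt n) φ.range =
        WittWhittaker.annihilator (WittWhittaker.Witt n) (WittWhittaker.LPos r μ) := by
  -- Simplicity of the lowest weight module enters here: it makes the embedded highest weight module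
  -- separate points, so the completion is the whole dual.
  refine (exists_LPos_hom_dual r μ).elim fun j hj => ?_
  refine (exists_completion_hom_dual (iSup_wtSpace_LPos r μ) (iSup_wtSpace_MNeg r (-μ))
    (finite_wtSpace_MNeg r (-μ)) j hj.1
    fun m hm => eq_zero_of_forall_dual_apply_eq_zero j hj.2 hm).elim fun E hE => ?_
  exact whittaker_of_completion span_range_D (lie_D_mem_span_lower r) (isCompl_nPos_bNeg r)
    (extendChar (closed_negIdx r) (fun _ => negIdx_disjoint r) (-μ)) j hj.1 hj.2 E hE lam
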